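/- Let $n\ge 1$, $m\ge 0$ be integers and consider a linear system of ordinary differential equations $$\mathbf y^{(n)}+B_n^1\,\mathbf y^{(n-1)}+\dots+B_n^n\,\mathbf y=0 \qquad (\ast)$$ for $\mathbf y=(y_1,\dots,y_m)$, where the $B_n^k$ are $m\times m$ matrices of functions of the independent variable. "Function" is understood locally, in either of the following senses: (a) over $K=\mathbb R$ (resp. $K=\mathbb C$), functions that are smooth (resp. holomorphic) near a given point $z_0$, all identities being required near $z_0$; (b) over an arbitrary field $K$ of characteristic zero, formal power series in $K[[z]]$, the functions of the independent and the dependent variables being formal power series at a base point. A normal form of $(\ast)$ is a system without term of order $n-1$ that arises from $(\ast)$ by a change $\mathbf y=Q\mathbf w$ of the dependent variables, where $Q$ is an invertible matrix of functions of the independent variable (after multiplication from the left by $Q^{-1}$). A scalar equation $w^{(n)}+A_n^1w^{(n-1)}+A_n^2w^{(n-2)}+\dots+A_n^nw=0$ is called iterative if there are functions $r,s$, with $r$ invertible, such that for $\Psi=r\frac{d}{dz}+s$ its left-hand side equals $r^{-n}\,\Psi^n[w]$ for all $w$. The system $(\ast)$ is reducible to the canonical form $\mathbf y^{(n)}=0$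 by an invertible point transformation if there is an invertible local (resp. formal) change of variables $x=F(z,\mathbf w)$, $\mathbf y=T(z,\mathbf w)$ of the $(m+1)$-dimensional space of the independent and the dependent variables, around some point over $z_0$ (resp. over $z=0$), such that a curve $z\mapsto(z,\mathbf w(z))$ in its domain with $dx/dz$ invertible along it is a solution of $(\ast)$ if and only if its image satisfies $d^n\mathbf y/dx^n=0$. (In the formal case the curves have coefficients in arbitrary commutative $K$-algebras and pass through points whose coordinates differ from those of the base point by nilpotents.) Theorem 2. In both settings, every system $(\ast)$ has a normal form; and for every normal form of $(\ast)$, the system $(\ast)$ is reducible by an invertible point transformation to the canonical form $\mathbf y^{(n)}=0$ if and only if that normal form has the expression $$0=\mathbf w^{(n)}+A_n^2\,I_m\,\mathbf w^{(n-2)}+\dots+A_n^n\,I_m\,\mathbf w,$$ where $I_m$ is the identity matrix and the $A_n^j=A_n^j(z)$ are scalar functions such that $$0=w^{(n)}+A_n^2\,w^{(n-2)}+\dots+A_n^n\,w$$ is a scalar linear iterative equation. That is, the normal form consists of $m$ copies of one scalar iterative equation. -/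

import Mathlib

open scoped ContDiff Topology Matrix

namespace LinearODE

/-! ### Differential expressions

`A` is a ring of functions of one variable and `δ` its derivative: below, either all functions
`𝕜 → 𝕜` with `deriv`, or the formal power series with the formal derivative. -/

section Operators

variable {A : Type*} [CommRing A] (δ : A → A)

/-- Left-hand side of the linear system `y⁽ⁿ⁾ + ∑_{k < n} B k · y⁽ᵏ⁾ = 0` in `m` unknowns. The
coefficient matrices are indexed by the order of the derivative which they multiply. -/
def systemOp {n m : ℕ} (B : Fin n → Matrix (Fin m) (Fin m) A) (y : Fin m → A) : Fin m → A :=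
  fun i => δ^[n] (y i) + ∑ k : Fin n, (B k *ᵥ fun j => δ^[k] (y j)) i

/-- Left-hand side of the scalar equation `y⁽ⁿ⁾ + ∑_{k < n} a k · y⁽ᵏ⁾ = 0`. -/
def scalarOp {n : ℕ} (a : Fin n → A) (y : A) : A :=
  δ^[n] y + ∑ k : Fin n, a k * δ^[k] y

/-- The first-order operator `Ψ = r d/dz + s`. -/
def psi (r s : A) (y : A) : A := r * δ y + s * y

/-- For `u = (dx/dz)⁻¹`, this is the derivative `d/dx = (dx/dz)⁻¹ d/dz` along a curve that is
parametrised by `z`. -/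
def derivBy (u : A) (y : A) : A := u * δ y

end Operators

/-! ### Smooth functions of a real variable, holomorphic functions of a complex variable -/

section Smooth

variable {𝕜 : Type*} [RCLike 𝕜]

/-- `f` is smooth (holomorphic if `𝕜 = ℂ`) on a neighbourhood of `z₀`. -/
def SmoothNear (z₀ : 𝕜) (f : 𝕜 → 𝕜) : Prop := ∀ᶠ z in 𝓝 z₀, ContDiffAt 𝕜 ∞ f z

/-- Near `z₀`, a change `y = Q(z) w` of the dependent variables with `Q` invertible turns the
system with coefficients `B` into the system with coefficients `N`, and in the latter the term of
order `n - 1` is absent. -/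
def IsNormalForm (z₀ : 𝕜) {n m : ℕ} (B N : Fin n → Matrix (Fin m) (Fin m) (𝕜 → 𝕜)) : Prop :=
  (∀ k i j, SmoothNear z₀ (N k i j)) ∧
  (∀ k : Fin n, (k : ℕ) + 1 = n → ∀ i j, N k i j =ᶠ[𝓝 z₀] 0) ∧
  ∃ Q : Matrix (Fin m) (Fin m) (𝕜 → 𝕜),
    (∀ i j, SmoothNear z₀ (Q i j)) ∧ Q.det z₀ ≠ 0 ∧
    ∀ w : Fin m → 𝕜 → 𝕜, (∀ j, SmoothNear z₀ (w j)) →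
      ∀ i, systemOp deriv B (Q *ᵥ w) i =ᶠ[𝓝 z₀] (Q *ᵥ systemOp deriv N w) i

/-- Near `z₀`, the scalar equation `y⁽ⁿ⁾ + ∑_{k < n} a k · y⁽ᵏ⁾ = 0` is iterative: up to the
leading coefficient `rⁿ`, its left-hand side is `Ψⁿ y` with `Ψ = r d/dz + s`. -/
def IsIterative (z₀ : 𝕜) {n : ℕ} (a : Fin n → 𝕜 → 𝕜) : Prop :=
  ∃ r s : 𝕜 → 𝕜, SmoothNear z₀ r ∧ SmoothNear z₀ s ∧ r z₀ ≠ 0 ∧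
    ∀ y : 𝕜 → 𝕜, SmoothNear z₀ y →
      (psi deriv r s)^[n] y =ᶠ[𝓝 z₀] r ^ n * scalarOp deriv a y

/-- Near `z₀`, the system with coefficients `N` is
`w⁽ⁿ⁾ + a_{n-2} I w⁽ⁿ⁻²⁾ + ⋯ + a₀ I w = 0`, where the scalar equation
`w⁽ⁿ⁾ + a_{n-2} w⁽ⁿ⁻²⁾ + ⋯ + a₀ w = 0` is iterative. -/
def IsIsotropicIterative (z₀ : 𝕜) {n m : ℕ}
    (N : Fin n → Matrix (Fin m) (Fin m) (𝕜 → 𝕜)) : Prop :=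
  ∃ a : Fin n → 𝕜 → 𝕜,
    (∀ k, SmoothNear z₀ (a k)) ∧
    (∀ k : Fin n, (k : ℕ) + 1 = n → a k =ᶠ[𝓝 z₀] 0) ∧
    (∀ k i j, N k i j =ᶠ[𝓝 z₀] (a k • (1 : Matrix (Fin m) (Fin m) (𝕜 → 𝕜))) i j) ∧
    IsIterative z₀ a

/-- The local diffeomorphism `Φ`, written `(z, w) ↦ (x, y)`, transforms the system with
coefficients `B` in the variables `(z, w)` into `dⁿy/dxⁿ = 0`: a curve `z ↦ (z, w(z))` in the
domain of `Φ`, along which `x` can serve as independent variable, is a solution curve of the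
system if and only if its image is a solution curve of `dⁿy/dxⁿ = 0`. The curves run through all
points of the domain of `Φ`. -/
def MapsToCanonical {n m : ℕ} (B : Fin n → Matrix (Fin m) (Fin m) (𝕜 → 𝕜))
    (Φ : OpenPartialHomeomorph (𝕜 × (Fin m → 𝕜)) (𝕜 × (Fin m → 𝕜))) : Prop :=
  ∀ (z₁ : 𝕜) (w : Fin m → 𝕜 → 𝕜), (∀ j, SmoothNear z₁ (w j)) →
    (z₁, fun j => w j z₁) ∈ Φ.source →
    ∀ (x : 𝕜 → 𝕜) (y : Fin m → 𝕜 → 𝕜),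
      (x = fun z => (Φ (z, fun j => w j z)).1) →
      (y = fun i z => (Φ (z, fun j => w j z)).2 i) →
      deriv x z₁ ≠ 0 →
      ((∀ i, systemOp deriv B w i =ᶠ[𝓝 z₁] 0) ↔
        ∀ i, (derivBy deriv (deriv x)⁻¹)^[n] (y i) =ᶠ[𝓝 z₁] 0)

/-- Over a neighbourhood of `z₀`, the system with coefficients `B` is reducible to the canonical
form `dⁿy/dxⁿ = 0` by an invertible point transformation, that is, by a local diffeomorphism
`x = x(z, w)`, `y = y(z, w)` of the space of independent and dependent variables. -/
def Reducible (z₀ : 𝕜) {n m : ℕ} (B : Fin n → Matrix (Fin m) (Fin m) (𝕜 → 𝕜)) : Prop :=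
  ∃ Φ : OpenPartialHomeomorph (𝕜 × (Fin m → 𝕜)) (𝕜 × (Fin m → 𝕜)),
    (∃ w₀ : Fin m → 𝕜, (z₀, w₀) ∈ Φ.source) ∧
    ContDiffOn 𝕜 ∞ Φ Φ.source ∧ ContDiffOn 𝕜 ∞ Φ.symm Φ.target ∧
    MapsToCanonical B Φ

end Smooth

/-! ### Formal power series over an arbitrary field of characteristic zero -/

namespace Formal

open PowerSeries

universe u

/-- The derivative `d/dz` of formal power series. -/
noncomputable def D (R : Type*) [CommRing R] (f : R⟦X⟧) : R⟦X⟧ := derivative R f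

section

variable {K : Type u} [Field K]

/-- A change `y = Q(z) w` of the dependent variables with `Q` invertible turns the system with
coefficients `B` into the system with coefficients `N`, and in the latter the term of order
`n - 1` is absent. -/
def IsNormalForm {n m : ℕ} (B N : Fin n → Matrix (Fin m) (Fin m) K⟦X⟧) : Prop :=
  (∀ k : Fin n, (k : ℕ) + 1 = n → N k = 0) ∧
  ∃ Q : Matrix (Fin m) (Fin m) K⟦X⟧, IsUnit Q.det ∧
    ∀ w : Fin m → K⟦X⟧, systemOp (D K) B (Q *ᵥ w) = Q *ᵥ systemOp (D K) N w

/-- The scalar equation `y⁽ⁿ⁾ + ∑_{k < n} a k · y⁽ᵏ⁾ = 0` is iterative: up to the leading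
coefficient `rⁿ`, its left-hand side is `Ψⁿ y` with `Ψ = r d/dz + s`. -/
def IsIterative {n : ℕ} (a : Fin n → K⟦X⟧) : Prop :=
  ∃ r s : K⟦X⟧, IsUnit r ∧
    ∀ y : K⟦X⟧, (psi (D K) r s)^[n] y = r ^ n * scalarOp (D K) a y

/-- The system with coefficients `N` is `w⁽ⁿ⁾ + a_{n-2} I w⁽ⁿ⁻²⁾ + ⋯ + a₀ I w = 0`, where the
scalar equation `w⁽ⁿ⁾ + a_{n-2} w⁽ⁿ⁻²⁾ + ⋯ + a₀ w = 0` is iterative. -/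
def IsIsotropicIterative {n m : ℕ} (N : Fin n → Matrix (Fin m) (Fin m) K⟦X⟧) : Prop :=
  ∃ a : Fin n → K⟦X⟧,
    (∀ k : Fin n, (k : ℕ) + 1 = n → a k = 0) ∧
    (∀ k, N k = a k • (1 : Matrix (Fin m) (Fin m) K⟦X⟧)) ∧
    IsIterative a

/-- Components of a formal map of the space of the variables `(z, w₁, …, w_m)`, as power series in
`z` (index `none`) and in the increments `w_j - w_j⁰` (index `some j`) from a base point; the
component `none` of the map is `x`, and the component `some i` is `y_i`. -/
abbrev PointMap (K : Type u) [Field K] (m : ℕ) : Type u :=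
  Option (Fin m) → MvPowerSeries (Option (Fin m)) K

/-- The Jacobian matrix of a formal map at the base point. -/
noncomputable def PointMap.jacobian {m : ℕ} (Φ : PointMap K m) :
    Matrix (Option (Fin m)) (Option (Fin m)) K :=
  Matrix.of fun a b => MvPowerSeries.coeff (Finsupp.single b 1) (Φ a)

/-- The image of the curve `z ↦ (z, w⁰ + η(z))` under a formal map. The curve may have coefficients
in any commutative `K`-algebra `R`. -/
noncomputable def PointMap.alongCurve {m : ℕ} (Φ : PointMap K m) {R : Type u} [CommRing R]
    [Algebra K R] (η : Fin m → R⟦X⟧) (a : Option (Fin m)) : R⟦X⟧ :=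
  MvPowerSeries.subst (fun o : Option (Fin m) => (o.elim X η : R⟦X⟧)) (Φ a)

/-- The formal map `Φ` at the base point `(0, w⁰)`, written `(z, w) ↦ (x, y)`, transforms the
system with coefficients `B` in the variables `(z, w)` into `dⁿy/dxⁿ = 0`: a curve
`z ↦ (z, w(z))`, along which `x` can serve as independent variable, is a solution curve of the
system if and only if its image is a solution curve of `dⁿy/dxⁿ = 0`.

As in the smooth case, the curves have to run through all points near the base point, and not only
through the base point itself. The points infinitely near the base point are those with
coordinates in a commutative `K`-algebra `R` that differ from the ones of the base point by
nilpotents. -/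
def MapsToCanonical {n m : ℕ} (B : Fin n → Matrix (Fin m) (Fin m) K⟦X⟧)
    (w₀ : Fin m → K) (Φ : PointMap K m) : Prop :=
  ∀ (R : Type u) [CommRing R] [Algebra K R] (η : Fin m → R⟦X⟧),
    (∀ j, IsNilpotent (constantCoeff (η j))) →
    ∀ u : R⟦X⟧, u * D R (Φ.alongCurve η none) = 1 →
      (systemOp (D R) (fun k => (B k).map (PowerSeries.map (algebraMap K R)))
          (fun j => C (algebraMap K R (w₀ j)) + η j) = 0 ↔
        ∀ i, (derivBy (D R) u)^[n] (Φ.alongCurve η (some i)) = 0)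

/-- The system with coefficients `B` is reducible to the canonical form `dⁿy/dxⁿ = 0` by an
invertible formal point transformation `x = x(z, w)`, `y = y(z, w)`. -/
def Reducible {n m : ℕ} (B : Fin n → Matrix (Fin m) (Fin m) K⟦X⟧) : Prop :=
  ∃ (w₀ : Fin m → K) (Φ : PointMap K m), Φ.jacobian.det ≠ 0 ∧ MapsToCanonical B w₀ Φ

end

end Formal

end LinearODE

namespace LinearODE

open Finset

/-! Both settings are instances of one algebraic situation: a commutative ring with a derivation
`δ`, in which nonzero integers are invertible, some element has derivative 1, and every linear
system `Q' = M Q` has an invertible solution (`HasFundamentalMatrices`). Power series over `K` form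
such a ring, and so do germs of smooth or holomorphic functions at `z₀`.

Normal forms: substituting `y = Q w` makes the coefficient of order `n - 1` equal to `n Q' + B Q`,
with `B` the old coefficient of that order, so it suffices to solve `Q' = -(1/n) B Q`
(`exists_isNormalFormVia`).

Sufficiency: if the normal form is given by `Ψ = r δ + s`, choose an invertible `μ` with `r μ' = s
μ`. Then `(r δ) ∘ μ = μ ∘ Ψ`, so with `dx = dz / r` and `P = μ Q⁻¹` one gets `(d/dx)ⁿ (P w) = rⁿ P L
w`, where `L` is the operator of the system (`exists_linear_canonical`). The transformation `(x(z),
P(z) w)` is therefore as required.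

Necessity: the point transformation may be nonlinear, but it can be linearised along one solution
`w`. For every other solution `φ`, all curves `w + ε φ` are solutions, and their images satisfy
`dⁿy/dxⁿ = 0`. Differentiating at `ε = 0` (`variation_derivBy_iterate`) yields `(u δ)ⁿ (P φ) = 0`
with `u = dz/dx` and `P = ∂y/∂w - (dy/dx) ∂x/∂w`, which is invertible when the solution is
transversal to the level sets of `x` (`det_transversal_ne_zero`). An operator of order `n` killing
all solutions is a multiple of `L` (`derivBy_iterate_eq_of_solutions`). After replacing `P` by `P
Q`, the missing term of order `n - 1` forces `2 u P' + (n - 1) u' P = 0`. Hence `(u δ) ∘ P = P ∘ Ψ`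
with a scalar `Ψ`, and the normal form is `u⁻ⁿ Ψⁿ` in each component
(`isIsotropicIterativeOver_of_operator_eq`).

The parameter `ε` is a dual number in the formal case and a genuine second variable in the smooth
case. -/

theorem map_iterate_of_comm {A A' : Type*} {δ : A → A} {δ' : A' → A'} (f : A → A')
    (h : ∀ a, f (δ a) = δ' (f a)) (k : ℕ) (a : A) : f (δ^[k] a) = δ'^[k] (f a) :=
  (Function.Semiconj.iterate_right (f := f) (ga := δ) (gb := δ') h k) a

/-! ### Transport of differential expressions along ring homomorphisms. -/

section Functoriality

variable {A A' : Type*} [CommRing A] [CommRing A'] {δ : A → A} {δ' : A' → A'}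

/-- Here `δ` is a bare map, because `deriv` on the ring of all functions is not a derivation: it is
additive only on differentiable functions. -/
theorem map_systemOp (f : A →+* A') (h : ∀ a, f (δ a) = δ' (f a)) {n m : ℕ}
    (B : Fin n → Matrix (Fin m) (Fin m) A) (w : Fin m → A) (i : Fin m) :
    f (systemOp δ B w i) = systemOp δ' (fun k => (B k).map f) (fun j => f (w j)) i := by
  simp [systemOp, Matrix.mulVec, dotProduct, map_iterate_of_comm f h]

theorem map_mulVec (f : A →+* A') {m : ℕ} (Q : Matrix (Fin m) (Fin m) A) (w : Fin m → A)
    (i : Fin m) : f ((Q *ᵥ w) i) = (Q.map f *ᵥ fun j => f (w j)) i := by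
  simp [Matrix.mulVec, dotProduct]

theorem map_derivBy_iterate (f : A →+* A') (h : ∀ a, f (δ a) = δ' (f a)) (u y : A) (k : ℕ) :
    f ((derivBy δ u)^[k] y) = (derivBy δ' (f u))^[k] (f y) :=
  map_iterate_of_comm f (fun a => by simp [derivBy, h]) k y

theorem map_psi_iterate (f : A →+* A') (h : ∀ a, f (δ a) = δ' (f a)) (r s y : A) (k : ℕ) :
    f ((psi δ r s)^[k] y) = (psi δ' (f r) (f s))^[k] (f y) :=
  map_iterate_of_comm f (fun a => by simp [psi, h]) k y

theorem map_scalarOp (f : A →+* A') (h : ∀ a, f (δ a) = δ' (f a)) {n : ℕ}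
    (a : Fin n → A) (y : A) :
    f (scalarOp δ a y) = scalarOp δ' (fun k => f (a k)) (f y) := by
  simp [scalarOp, map_iterate_of_comm f h]

/-- Coefficients of `r δ ∘ ∑ k, c k δᵏ`. -/
def stepCoeff (δ : A → A) (r : A) {m : ℕ} (c : ℕ → Matrix (Fin m) (Fin m) A) :
    ℕ → Matrix (Fin m) (Fin m) A
  | 0 => r • (c 0).map δ
  | k + 1 => r • ((c (k + 1)).map δ + c k)

/-- Coefficients of the operator `w ↦ (r δ)ⁿ (P w)`. -/
def iterCoeff (δ : A → A) (r : A) {m : ℕ} (P : Matrix (Fin m) (Fin m) A) :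
    ℕ → ℕ → Matrix (Fin m) (Fin m) A
  | 0 => fun k => if k = 0 then P else 0
  | n + 1 => stepCoeff δ r (iterCoeff δ r P n)

/-- The coefficients are built from ring operations and `δ` alone. Identities between them can
therefore be moved from `K⟦X⟧` to `R⟦X⟧`, or between functions and germs. -/
theorem map_iterCoeff (f : A →+* A') (h : ∀ a, f (δ a) = δ' (f a)) (r : A) {m : ℕ}
    (P : Matrix (Fin m) (Fin m) A) (n k : ℕ) :
    (iterCoeff δ r P n k).map f = iterCoeff δ' (f r) (P.map f) n k := by
  induction n generalizing k with
  | zero =>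
    by_cases hk : k = 0
    · simp [iterCoeff, hk]
    · ext i j; simp [iterCoeff, hk]
  | succ n ih =>
    cases k with
    | zero =>
      rw [iterCoeff, iterCoeff, stepCoeff, stepCoeff, ← ih]
      ext i j
      simp [h]
    | succ k =>
      rw [iterCoeff, iterCoeff, stepCoeff, stepCoeff, ← ih, ← ih]
      ext i j
      simp [h, mul_add]

end Functoriality

/-! ### Coefficients of the operators `(r δ)ⁿ ∘ P`. -/

section Derivation

variable {A : Type*} [CommRing A] (δ : Derivation ℤ A A)

theorem sum_stepCoeff (r : A) {m : ℕ} (c : ℕ → Matrix (Fin m) (Fin m) A) (N : ℕ)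
    (hc : ∀ k, N ≤ k → c k = 0) (w : Fin m → A) (i : Fin m) :
    derivBy δ r (∑ k ∈ range N, (c k *ᵥ fun j => δ^[k] (w j)) i) =
      ∑ k ∈ range (N + 1), (stepCoeff δ r c k *ᵥ fun j => δ^[k] (w j)) i := by
  have h1 : ∀ k, (stepCoeff δ r c (k + 1) *ᵥ fun j => δ^[k + 1] (w j)) i =
      r * (((c (k + 1)).map δ *ᵥ fun j => δ^[k + 1] (w j)) i) +
      r * ((c k *ᵥ fun j => δ^[k + 1] (w j)) i) := by
    intro k
    rw [stepCoeff, Matrix.smul_mulVec, Matrix.add_mulVec]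
    simp [mul_add]
  have h2 : ∀ k, δ ((c k *ᵥ fun j => δ^[k] (w j)) i) =
      ((c k).map δ *ᵥ fun j => δ^[k] (w j)) i + (c k *ᵥ fun j => δ^[k + 1] (w j)) i := by
    intro k
    simp only [Matrix.mulVec, dotProduct, map_sum, Derivation.leibniz, smul_eq_mul,
      ← sum_add_distrib, Matrix.map_apply, Function.iterate_succ_apply']
    exact sum_congr rfl fun j _ => by ring
  have h0 : (stepCoeff δ r c 0 *ᵥ fun j => δ^[0] (w j)) i =
      r * (((c 0).map δ *ᵥ fun j => δ^[0] (w j)) i) := by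
    rw [stepCoeff, Matrix.smul_mulVec]; simp
  rw [sum_range_succ', sum_congr rfl fun k _ => h1 k, h0, derivBy, map_sum,
    sum_congr rfl fun k _ => h2 k, sum_add_distrib, sum_add_distrib, mul_add, mul_sum, mul_sum]
  -- Because `c N = 0`, the sum over `k < N` equals the one over `k < N + 1`, whose term at 0 can
  -- then be split off.
  have h3 := sum_range_succ' (fun k => r * ((c k).map δ *ᵥ fun j => δ^[k] (w j)) i) N
  rw [sum_range_succ, hc N le_rfl] at h3
  have h4 : ((0 : Matrix (Fin m) (Fin m) A).map δ) = 0 := by ext; simp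
  rw [h4, Matrix.zero_mulVec, Pi.zero_apply, mul_zero, add_zero] at h3
  rw [h3]; ring

theorem iterCoeff_eq_zero (r : A) {m : ℕ} (P : Matrix (Fin m) (Fin m) A) {n k : ℕ}
    (h : n < k) : iterCoeff δ r P n k = 0 := by
  induction n generalizing k with
  | zero => simp [iterCoeff, h.ne']
  | succ n ih =>
    obtain _ | k := k
    · omega
    · rw [iterCoeff, stepCoeff, ih (by omega), ih (by omega)]
      ext; simp

theorem map_smul_derivation (a : A) {m : ℕ} (P : Matrix (Fin m) (Fin m) A) :
    (a • P).map δ = a • P.map δ + δ a • P := by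
  ext; simp; ring

theorem iterCoeff_self (r : A) {m : ℕ} (P : Matrix (Fin m) (Fin m) A) (n : ℕ) :
    iterCoeff δ r P n n = r ^ n • P := by
  induction n with
  | zero => simp [iterCoeff]
  | succ n ih =>
    have h4 : ((0 : Matrix (Fin m) (Fin m) A).map δ) = 0 := by ext; simp
    rw [iterCoeff, stepCoeff, ih, iterCoeff_eq_zero δ r P (Nat.lt_succ_self n), h4, zero_add,
      smul_smul, pow_succ']

/-- The subleading coefficient is `(n+1) rⁿ (r P' + (n/2) r' P)`; doubling avoids division in a
general ring. This is the coefficient that the normal form condition controls. -/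
theorem two_smul_iterCoeff_succ (r : A) {m : ℕ} (P : Matrix (Fin m) (Fin m) A) (n : ℕ) :
    (2 : A) • iterCoeff δ r P (n + 1) n =
      ((n + 1 : ℕ) * r ^ n : A) • ((2 * r) • P.map δ + (n * δ r : A) • P) := by
  induction n with
  | zero => ext; simp [iterCoeff, stepCoeff]; ring
  | succ n ih =>
    rw [iterCoeff, stepCoeff, iterCoeff_self, map_smul_derivation, smul_comm, smul_add (2 : A), ih]
    ext i j
    simp [Derivation.leibniz_pow]
    ring

theorem derivBy_iterate_mulVec (r : A) {m : ℕ} (P : Matrix (Fin m) (Fin m) A) (n : ℕ)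
    (w : Fin m → A) (i : Fin m) :
    (derivBy δ r)^[n] ((P *ᵥ w) i) =
      ∑ k ∈ range (n + 1), (iterCoeff δ r P n k *ᵥ fun j => δ^[k] (w j)) i := by
  induction n with
  | zero => simp [iterCoeff]
  | succ n ih =>
    rw [Function.iterate_succ_apply', ih, sum_stepCoeff δ r _ _
      (fun k hk => iterCoeff_eq_zero δ r P hk)]
    rfl

/-- The operator `w ↦ (r δ)ⁿ (P w) - rⁿ P (L w)` has order less than `n`. -/
theorem derivBy_iterate_mulVec_eq (r : A) {n m : ℕ} (P : Matrix (Fin m) (Fin m) A)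
    (B : Fin n → Matrix (Fin m) (Fin m) A) (w : Fin m → A) (i : Fin m) :
    (derivBy δ r)^[n] ((P *ᵥ w) i) = ((r ^ n • P) *ᵥ systemOp δ B w) i +
      ∑ k : Fin n, ((iterCoeff δ r P n k - (r ^ n • P) * B k) *ᵥ fun j => δ^[k] (w j)) i := by
  have h : systemOp δ B w =
      (fun i => δ^[n] (w i)) + ∑ k : Fin n, (B k *ᵥ fun j => δ^[k] (w j)) := by
    ext i; simp [systemOp]
  rw [derivBy_iterate_mulVec, sum_range_succ, iterCoeff_self, h, Matrix.mulVec_add,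
    Matrix.mulVec_sum, ← Fin.sum_univ_eq_sum_range
      (fun k => (iterCoeff δ r P n k *ᵥ fun j => δ^[k] (w j)) i)]
  simp only [Matrix.sub_mulVec, Pi.sub_apply, sum_sub_distrib, Pi.add_apply, Finset.sum_apply,
    Matrix.mulVec_mulVec]
  ring

/-- A function with derivative `1` shows that differential operators determine their
coefficients. -/
theorem eq_zero_of_operator_eq_zero {t : A} (ht : δ t = 1)
    (hN : ∀ n : ℕ, n ≠ 0 → IsUnit (n : A)) {n m : ℕ} (c : Fin n → Matrix (Fin m) (Fin m) A)
    (h : ∀ (w : Fin m → A) (i), ∑ k : Fin n, (c k *ᵥ fun j => δ^[k] (w j)) i = 0) (k : Fin n) :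
    c k = 0 := by
  have hpow : ∀ p q : ℕ, δ^[p] (t ^ q) = q.descFactorial p * t ^ (q - p) := by
    intro p q
    induction p with
    | zero => simp
    | succ p ih =>
      rw [Function.iterate_succ_apply', ih, Nat.descFactorial_succ]
      simp [Derivation.leibniz, Derivation.leibniz_pow, ht, Nat.sub_sub]
      ring
  obtain ⟨k, hk⟩ := k
  induction k using Nat.strong_induction_on with
  | _ k ih =>
    ext i j
    -- Test on `t ^ k` in the `j`-th component: the orders below `k` have zero coefficient by
    -- induction, those above `k` kill `t ^ k`, and order `k` contributes `k!` times column `j`.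
    have h1 := h (fun l => if l = j then t ^ k else 0) i
    rw [sum_eq_single (⟨k, hk⟩ : Fin n)] at h1
    · have h2 : (fun l : Fin m => δ^[k] (if l = j then t ^ k else 0)) =
          Pi.single j (k.factorial : A) := by
        ext l
        by_cases hl : l = j
        · subst hl; simp [hpow, Nat.descFactorial_self]
        · simp [hl]
      simp only [h2] at h1
      rw [Matrix.mulVec_single] at h1
      simpa using (hN _ k.factorial_ne_zero).mul_left_eq_zero.1 (by simpa using h1)
    · rintro ⟨l, hl⟩ - hne
      rcases lt_or_gt_of_ne (show l ≠ k from fun e => hne (by simp [e])) with hlt | hgt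
      · simp [ih l hlt hl]
      · have h2 : (fun q : Fin m => δ^[l] (if q = j then t ^ k else 0)) = 0 := by
          ext q
          by_cases hq : q = j
          · simp [hq, hpow, Nat.descFactorial_of_lt hgt]
          · simp [hq]
        simp only [h2, Matrix.mulVec_zero, Pi.zero_apply]
    · simp

end Derivation

/-- Derivations of a commutative ring. -/
abbrev RingDerivation (A : Type*) [CommRing A] := Derivation ℤ A A

/-- An additive map satisfying the Leibniz rule, as a derivation. -/
def ringDerivation {A : Type*} [CommRing A] (d : A →+ A)
    (h : ∀ a b, d (a * b) = a * d b + b * d a) : RingDerivation A :=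
  Derivation.mk' d.toIntLinearMap h

/-! ### The theorem for linear operators over a differential ring. -/

section Abstract

variable {A : Type*} [CommRing A] (δ : Derivation ℤ A A)

/-- Every linear system `Q' = M Q` over the differential ring has an invertible solution. -/
def HasFundamentalMatrices : Prop :=
  ∀ (ι : Type) [Fintype ι] [DecidableEq ι] (M : Matrix ι ι A),
    ∃ Q : Matrix ι ι A, IsUnit Q.det ∧ Q.map δ = M * Q

/-- `y = Q w` brings the system with coefficients `B` into the normal form with coefficients `N`. -/
def IsNormalFormVia {n m : ℕ} (B N : Fin n → Matrix (Fin m) (Fin m) A)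
    (Q : Matrix (Fin m) (Fin m) A) : Prop :=
  (∀ k : Fin n, (k : ℕ) + 1 = n → N k = 0) ∧ IsUnit Q.det ∧
    ∀ w : Fin m → A, systemOp δ B (Q *ᵥ w) = Q *ᵥ systemOp δ N w

/-- The system consists of copies of one scalar iterative equation without term of order
`n - 1`. -/
def IsIsotropicIterativeOver {n m : ℕ} (N : Fin n → Matrix (Fin m) (Fin m) A) : Prop :=
  ∃ a : Fin n → A,
    (∀ k : Fin n, (k : ℕ) + 1 = n → a k = 0) ∧
    (∀ k, N k = a k • (1 : Matrix (Fin m) (Fin m) A)) ∧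
    ∃ r s : A, IsUnit r ∧ ∀ y : A, (psi δ r s)^[n] y = r ^ n * scalarOp δ a y

variable {δ}

theorem derivBy_one_iterate (k : ℕ) (a : A) : (derivBy δ 1)^[k] a = δ^[k] a := by
  have : derivBy δ 1 = δ := by ext; simp [derivBy]
  rw [this]

/-- With `n + 1` as order, the subleading coefficient after substitution is `(n+1) Q' + B Q`, which
vanishes for a fundamental matrix of `Q' = -(n+1)⁻¹ B Q`. -/
theorem exists_isNormalFormVia (hN : ∀ n : ℕ, n ≠ 0 → IsUnit (n : A))
    (hS : HasFundamentalMatrices δ) {n m : ℕ} (hn : 1 ≤ n)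
    (B : Fin n → Matrix (Fin m) (Fin m) A) : ∃ N Q, IsNormalFormVia δ B N Q := by
  obtain ⟨n, rfl⟩ : ∃ p, n = p + 1 := ⟨n - 1, by omega⟩
  obtain ⟨v, hv⟩ := (hN (n + 1) n.succ_ne_zero).exists_right_inv
  obtain ⟨v₂, hv₂⟩ := (hN 2 two_ne_zero).exists_right_inv
  obtain ⟨Q, hQ, hQ'⟩ := hS (Fin m) (-v • B (Fin.last n))
  -- Coefficients of `w ↦ L (Q w)`. The leading one is `Q`, so that `Q⁻¹ c` has leading coefficient
  -- 1.
  let c : ℕ → Matrix (Fin m) (Fin m) A := fun j =>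
    iterCoeff δ 1 Q (n + 1) j + ∑ k : Fin (n + 1), B k * iterCoeff δ 1 Q k j
  refine ⟨fun j => Q⁻¹ * c j, Q, ?_, hQ, fun w => ?_⟩
  · intro k hk
    obtain rfl : k = Fin.last n := Fin.ext (by simpa using hk)
    have h1 : ∑ k : Fin (n + 1), B k * iterCoeff δ 1 Q k n = B (Fin.last n) * Q := by
      rw [Fin.sum_univ_castSucc, sum_eq_zero, zero_add, Fin.val_last, iterCoeff_self, one_pow,
        one_smul]
      intro k _
      rw [iterCoeff_eq_zero δ 1 Q (by simp), mul_zero]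
    have h2 : iterCoeff δ 1 Q (n + 1) n = ((n + 1 : ℕ) : A) • Q.map δ := by
      have h3 := two_smul_iterCoeff_succ δ 1 Q n
      have h4 := congrArg (v₂ • ·) h3
      simp only [smul_smul] at h4
      push_cast at hv₂
      rw [mul_comm v₂ 2, hv₂, one_smul] at h4
      rw [h4]
      ext i j
      simp
      linear_combination ((n : A) + 1) * δ (Q i j) * hv₂
    have h3 : c n = 0 := by
      simp only [c]
      rw [h1, h2, hQ', Matrix.smul_mul, smul_smul, mul_neg, hv]
      simp
    simp only [Fin.val_last, h3, mul_zero]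
  · have h1 : ∀ k : ℕ, k ≤ n + 1 → (fun i => δ^[k] ((Q *ᵥ w) i)) =
        ∑ j ∈ range (n + 2), iterCoeff δ 1 Q k j *ᵥ fun i => δ^[j] (w i) := by
      intro k hk
      ext i
      rw [← derivBy_one_iterate, derivBy_iterate_mulVec, Finset.sum_apply]
      refine sum_subset (range_subset_range.2 (by omega)) fun j _ hj => ?_
      rw [iterCoeff_eq_zero δ 1 Q (by simpa using hj)]
      simp
    have h2 : systemOp δ B (Q *ᵥ w) = (fun i => δ^[n + 1] ((Q *ᵥ w) i)) +
        ∑ k : Fin (n + 1), B k *ᵥ fun i => δ^[k] ((Q *ᵥ w) i) := by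
      ext i; simp [systemOp]
    have h3 : systemOp δ B (Q *ᵥ w) = ∑ j ∈ range (n + 2), c j *ᵥ fun i => δ^[j] (w i) := by
      rw [h2, h1 _ le_rfl]
      simp only [c, Matrix.add_mulVec, sum_add_distrib, Matrix.sum_mulVec]
      congr 1
      rw [sum_comm]
      refine sum_congr rfl fun k _ => ?_
      rw [h1 k (by omega), Matrix.mulVec_sum]
      simp only [Matrix.mulVec_mulVec]
    have h4 : c (n + 1) = Q := by
      simp only [c]
      rw [iterCoeff_self, sum_eq_zero, one_pow, one_smul, add_zero]
      intro k _
      rw [iterCoeff_eq_zero δ 1 Q k.2, mul_zero]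
    have h5 : systemOp δ (fun j : Fin (n + 1) => Q⁻¹ * c j) w = (fun i => δ^[n + 1] (w i)) +
        ∑ k : Fin (n + 1), (Q⁻¹ * c k) *ᵥ fun i => δ^[k] (w i) := by
      ext i; simp [systemOp]
    rw [h3, sum_range_succ, h4, h5, Matrix.mulVec_add, Matrix.mulVec_sum, add_comm,
      ← Fin.sum_univ_eq_sum_range (fun j => c j *ᵥ fun i => δ^[j] (w i))]
    simp only [Matrix.mulVec_mulVec, Matrix.mul_nonsing_inv_cancel_left _ _ hQ]

/-- A scalar iterative equation becomes `yⁿ = 0` in the variables `∫ dz / r` and `μ w`. -/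
theorem exists_linear_canonical (hS : HasFundamentalMatrices δ) {n m : ℕ}
    {B N : Fin n → Matrix (Fin m) (Fin m) A} {Q : Matrix (Fin m) (Fin m) A}
    (hQ : IsNormalFormVia δ B N Q) (hI : IsIsotropicIterativeOver δ N) :
    ∃ (r : A) (P : Matrix (Fin m) (Fin m) A), IsUnit r ∧ IsUnit P.det ∧
      ∀ w i, (derivBy δ r)^[n] ((P *ᵥ w) i) = ((r ^ n • P) *ᵥ systemOp δ B w) i := by
  obtain ⟨a, -, hNa, r, s, hr, hrs⟩ := hI
  obtain ⟨-, hdet, hQN⟩ := hQ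
  obtain ⟨ri, hri⟩ := hr.exists_right_inv
  -- The unit `μ` with `μ' = (s / r) μ` is a 1 × 1 fundamental matrix; it absorbs the term `s` of
  -- `Ψ`.
  obtain ⟨M, hM, hM'⟩ := hS (Fin 1) (Matrix.of fun _ _ => ri * s)
  set μ := M 0 0 with hμ
  have hμu : IsUnit μ := by simpa [hμ] using hM
  have hμ' : r * δ μ = s * μ := by
    have := congrFun (congrFun hM' 0) 0
    simp [Matrix.mul_apply] at this
    rw [hμ, this]
    linear_combination s * M 0 0 * hri
  have hstep : ∀ v, derivBy δ r (μ * v) = μ * psi δ r s v := by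
    intro v
    simp only [derivBy, psi, Derivation.leibniz, smul_eq_mul]
    linear_combination v * hμ'
  have hit : ∀ k v, (derivBy δ r)^[k] (μ * v) = μ * (psi δ r s)^[k] v := by
    intro k v
    exact ((Function.Semiconj.iterate_right (f := (μ * ·)) (fun v => (hstep v).symm) k) v).symm
  have hNsys : ∀ w i, systemOp δ N w i = scalarOp δ a (w i) := by
    intro w i
    simp [systemOp, scalarOp, hNa, Matrix.smul_mulVec]
  refine ⟨r, μ • Q⁻¹, hr, ?_, fun y i => ?_⟩
  · rw [Matrix.det_smul]
    exact (hμu.pow _).mul (Matrix.isUnit_nonsing_inv_det _ hdet)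
  · have hy : y = Q *ᵥ (Q⁻¹ *ᵥ y) := by
      rw [Matrix.mulVec_mulVec, Matrix.mul_nonsing_inv _ hdet, Matrix.one_mulVec]
    set w := Q⁻¹ *ᵥ y with hw
    rw [Matrix.smul_mulVec, ← hw, Pi.smul_apply, smul_eq_mul, hit, hrs, ← hNsys, hy, hQN,
      Matrix.smul_mulVec, Matrix.smul_mulVec, Matrix.mulVec_mulVec, Matrix.nonsing_inv_mul _ hdet,
      Matrix.one_mulVec]
    simp only [Pi.smul_apply, smul_eq_mul]
    ring

theorem exists_psi_iterate_coeff (r s : A) (n : ℕ) :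
    ∃ d : ℕ → A, d n = r ^ n ∧ ∀ y, (psi δ r s)^[n] y = ∑ k ∈ range (n + 1), d k * δ^[k] y := by
  -- The vanishing of `d` beyond `n` is added to carry the induction.
  suffices h : ∃ d : ℕ → A, d n = r ^ n ∧ (∀ k, n < k → d k = 0) ∧
      ∀ y, (psi δ r s)^[n] y = ∑ k ∈ range (n + 1), d k * δ^[k] y by
    obtain ⟨d, h1, -, h2⟩ := h; exact ⟨d, h1, h2⟩
  induction n with
  | zero => exact ⟨fun k => if k = 0 then 1 else 0, by simp, fun k hk => by simp [hk.ne'],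
      by simp⟩
  | succ n ih =>
    obtain ⟨d, h1, h2, h3⟩ := ih
    refine ⟨fun k => r * δ (d k) + s * d k + if k = 0 then 0 else r * d (k - 1), ?_, ?_, ?_⟩
    · simp [h2 (n + 1) (by omega), h1, pow_succ']
    · intro k hk
      simp [h2 k (by omega), h2 (k - 1) (by omega)]
    · intro y
      rw [Function.iterate_succ_apply', h3, psi, map_sum, mul_sum, mul_sum]
      simp only [add_mul, sum_add_distrib]
      rw [sum_range_succ _ (n + 1), sum_range_succ (fun k => s * d k * δ^[k] y) (n + 1),
        sum_range_succ' (fun k => (if k = 0 then 0 else r * d (k - 1)) * δ^[k] y),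
        h2 (n + 1) (by omega)]
      simp only [Derivation.leibniz, smul_eq_mul, mul_add, sum_add_distrib,
        Function.iterate_succ_apply', map_zero, mul_zero, zero_mul, add_zero, Nat.add_sub_cancel,
        if_true, Nat.succ_ne_zero, if_false]
      simp only [← sum_add_distrib]
      exact sum_congr rfl fun k _ => by ring

/-- Unlike an identity between operators on `A`, the resulting identity between coefficients can be
carried to other rings and base points, where `operator_eq_of_iterCoeff_eq` turns it back into one
between operators. -/
theorem iterCoeff_eq_of_operator_eq {t : A} (ht : δ t = 1)
    (hN : ∀ n : ℕ, n ≠ 0 → IsUnit (n : A)) {n m : ℕ} {B : Fin n → Matrix (Fin m) (Fin m) A}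
    {u : A} {P : Matrix (Fin m) (Fin m) A}
    (h : ∀ w i, (derivBy δ u)^[n] ((P *ᵥ w) i) = ((u ^ n • P) *ᵥ systemOp δ B w) i) (k : Fin n) :
    iterCoeff δ u P n k = (u ^ n • P) * B k := by
  refine sub_eq_zero.1 (eq_zero_of_operator_eq_zero δ ht hN
    (fun k : Fin n => iterCoeff δ u P n k - (u ^ n • P) * B k) ?_ k)
  intro w i
  have := derivBy_iterate_mulVec_eq δ u P B w i
  rw [h] at this
  exact left_eq_add.1 this

theorem operator_eq_of_iterCoeff_eq {n m : ℕ} {B : Fin n → Matrix (Fin m) (Fin m) A}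
    {u : A} {P : Matrix (Fin m) (Fin m) A}
    (h : ∀ k : Fin n, iterCoeff δ u P n k = (u ^ n • P) * B k) (w : Fin m → A) (i : Fin m) :
    (derivBy δ u)^[n] ((P *ᵥ w) i) = ((u ^ n • P) *ᵥ systemOp δ B w) i := by
  rw [derivBy_iterate_mulVec_eq δ u P B w i,
    sum_eq_zero fun k _ => by rw [sub_eq_zero.2 (h k)]; simp, add_zero]

/-- If `(u δ)ⁿ P` is a multiple of the operator of a normal form, then the normal form consists
of copies of one iterative equation. -/
theorem isIsotropicIterativeOver_of_operator_eq {t : A} (ht : δ t = 1)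
    (hN : ∀ n : ℕ, n ≠ 0 → IsUnit (n : A)) {n m : ℕ} (hn : 1 ≤ n)
    {N : Fin n → Matrix (Fin m) (Fin m) A} (hN0 : ∀ k : Fin n, (k : ℕ) + 1 = n → N k = 0)
    {u : A} (hu : IsUnit u) {P : Matrix (Fin m) (Fin m) A} (hP : IsUnit P.det)
    (h : ∀ w i, (derivBy δ u)^[n] ((P *ᵥ w) i) = ((u ^ n • P) *ᵥ systemOp δ N w) i) :
    IsIsotropicIterativeOver δ N := by
  obtain ⟨p, rfl⟩ : ∃ p, n = p + 1 := ⟨n - 1, by omega⟩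
  -- For `m = 0` the matrices carry no information about scalar coefficients, so the equation `δⁿ y
  -- = 0` is chosen; otherwise the condition on `a` is read off a diagonal entry.
  obtain rfl | hm := Nat.eq_zero_or_pos m
  · refine ⟨0, by simp, fun k => Subsingleton.elim _ _, 1, 0, isUnit_one, fun y => ?_⟩
    have : psi δ 1 0 = δ := by ext; simp [psi]
    simp [this, scalarOp]
  obtain ⟨v₂, hv₂⟩ := (hN 2 two_ne_zero).exists_right_inv
  push_cast at hv₂
  obtain ⟨uinv, huinv⟩ := hu.exists_right_inv
  have hcoeff := iterCoeff_eq_of_operator_eq ht hN h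
  -- Here `n = p + 1`. The missing term of order `p` gives `2 u P' + p u' P = 0`, that is, `u P' = s
  -- P` with a scalar `s`.
  set s := -v₂ * (p * δ u) with hs
  have hP' : ∀ i j, u * δ (P i j) = s * P i j := by
    have h1 := two_smul_iterCoeff_succ δ u P p
    have h2 := hcoeff (Fin.last p)
    rw [hN0 (Fin.last p) (by simp), mul_zero, Fin.val_last] at h2
    rw [h2, smul_zero] at h1
    intro i j
    have h3 := congrFun (congrFun h1 i) j
    simp only [Matrix.zero_apply, Matrix.smul_apply, Matrix.add_apply, Matrix.map_apply,
      smul_eq_mul] at h3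
    have h4 := ((hN (p + 1) p.succ_ne_zero).mul (hu.pow p)).mul_right_eq_zero.1 h3.symm
    rw [hs]
    linear_combination v₂ * h4 - u * δ (P i j) * hv₂
  -- Since `s` is scalar, `P` intertwines `u δ` with `Ψ` acting separately on each component.
  have hstep : ∀ (w : Fin m → A) i, derivBy δ u ((P *ᵥ w) i) =
      (P *ᵥ fun j => psi δ u s (w j)) i := by
    intro w i
    simp only [derivBy, psi, Matrix.mulVec, dotProduct, map_sum, mul_sum, Derivation.leibniz,
      smul_eq_mul]
    exact sum_congr rfl fun j _ => by linear_combination w j * hP' i j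
  have hit : ∀ k (w : Fin m → A) i, (derivBy δ u)^[k] ((P *ᵥ w) i) =
      (P *ᵥ fun j => (psi δ u s)^[k] (w j)) i := by
    intro k
    induction k with
    | zero => intro w i; rfl
    | succ k ih => intro w i; rw [Function.iterate_succ_apply, hstep, ih]; rfl
  have hpsi : ∀ (w : Fin m → A) j,
      (psi δ u s)^[p + 1] (w j) = u ^ (p + 1) * systemOp δ N w j := by
    intro w
    have h1 : P *ᵥ (fun j => (psi δ u s)^[p + 1] (w j)) =
        P *ᵥ (u ^ (p + 1) • systemOp δ N w) := by
      ext i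
      rw [← hit, h, Matrix.smul_mulVec, Matrix.mulVec_smul]
    have h2 := congrArg (P⁻¹ *ᵥ ·) h1
    simp only [Matrix.mulVec_mulVec, Matrix.nonsing_inv_mul _ hP, Matrix.one_mulVec] at h2
    exact fun j => congrFun h2 j
  obtain ⟨d, hd, hpsid⟩ := exists_psi_iterate_coeff (δ := δ) u s (p + 1)
  let a : Fin (p + 1) → A := fun k => uinv ^ (p + 1) * d k
  have hui : u ^ (p + 1) * uinv ^ (p + 1) = 1 := by rw [← mul_pow, huinv, one_pow]
  have ha : ∀ y, (psi δ u s)^[p + 1] y = u ^ (p + 1) * scalarOp δ a y := by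
    intro y
    rw [hpsid, sum_range_succ, ← Fin.sum_univ_eq_sum_range (fun k => d k * δ^[k] y), hd, scalarOp,
      mul_add, mul_sum, add_comm]
    congr 1
    exact sum_congr rfl fun k _ => by linear_combination (-d k * δ^[k] y) * hui
  have hNa : ∀ k, N k = a k • (1 : Matrix (Fin m) (Fin m) A) := by
    intro k
    refine sub_eq_zero.1 (eq_zero_of_operator_eq_zero δ ht hN
      (fun k : Fin (p + 1) => N k - a k • (1 : Matrix (Fin m) (Fin m) A)) ?_ k)
    intro w i
    have h1 := hpsi w i
    rw [ha] at h1
    have h2 := (hu.pow (p + 1)).mul_left_cancel h1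
    simp only [scalarOp, systemOp, add_right_inj] at h2
    simp [Matrix.sub_mulVec, Matrix.smul_mulVec, h2]
  refine ⟨a, fun k hk => ?_, hNa, u, s, hu, ha⟩
  have := congrFun (congrFun (hNa k) ⟨0, hm⟩) ⟨0, hm⟩
  rw [hN0 k hk] at this
  simpa using this.symm

/-- `W` is a fundamental matrix of the companion system of first order: block `k` of a column is the
`k`-th derivative of block 0, and the last block row encodes the equation. -/
theorem exists_companion_solution (hS : HasFundamentalMatrices δ) {n m : ℕ} (hn : 1 ≤ n)
    (B : Fin n → Matrix (Fin m) (Fin m) A) :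
    ∃ W : Matrix (Fin n × Fin m) (Fin n × Fin m) A, IsUnit W.det ∧
      ∀ c, systemOp δ B (fun j => W (⟨0, hn⟩, j) c) = 0 ∧
        ∀ (k : Fin n) (j : Fin m), δ^[(k : ℕ)] (W (⟨0, hn⟩, j) c) = W (k, j) c := by
  obtain ⟨W, hW, hW'⟩ := hS (Fin n × Fin m) (Matrix.of fun k l =>
    if (k.1 : ℕ) + 1 < n then (if (l.1 : ℕ) = k.1 + 1 ∧ l.2 = k.2 then 1 else 0)
    else - B l.1 k.2 l.2)
  have hδ : ∀ k j c, δ (W (k, j) c) = ∑ l : Fin n × Fin m,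
      (if (k : ℕ) + 1 < n then (if (l.1 : ℕ) = k + 1 ∧ l.2 = j then 1 else 0)
        else - B l.1 j l.2) * W l c := fun k j c => congrFun (congrFun hW' (k, j)) c
  have hnext : ∀ (k : ℕ) (hk : k + 1 < n) j c,
      δ (W (⟨k, by omega⟩, j) c) = W (⟨k + 1, hk⟩, j) c := by
    intro k hk j c
    rw [hδ, sum_eq_single ((⟨k + 1, hk⟩, j) : Fin n × Fin m)]
    · simp [hk]
    · rintro ⟨l, i⟩ - hne
      rw [if_pos hk, if_neg, zero_mul]
      rintro ⟨h1, h2⟩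
      exact hne (Prod.ext (Fin.ext h1) h2)
    · simp
  have hit : ∀ (k : ℕ) (hk : k < n) j c, δ^[k] (W (⟨0, hn⟩, j) c) = W (⟨k, hk⟩, j) c := by
    intro k
    induction k with
    | zero => intro hk j c; rfl
    | succ k ih => intro hk j c; rw [Function.iterate_succ_apply', ih (by omega), hnext k hk]
  refine ⟨W, hW, fun c => ⟨?_, fun k j => hit k k.2 j c⟩⟩
  ext i
  obtain ⟨p, rfl⟩ : ∃ p, n = p + 1 := ⟨n - 1, by omega⟩
  have h1 : δ^[p + 1] (W (⟨0, hn⟩, i) c) =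
      - ∑ k : Fin (p + 1), ∑ j, B k i j * W (k, j) c := by
    rw [Function.iterate_succ_apply', hit p (by omega), hδ, ← sum_neg_distrib,
      Fintype.sum_prod_type]
    refine sum_congr rfl fun k _ => ?_
    rw [← sum_neg_distrib]
    exact sum_congr rfl fun j _ => by simp
  simp only [systemOp, h1, Matrix.mulVec, dotProduct, hit _ (Fin.is_lt _), Fin.eta]
  simp

/-- Combinations of the columns of `W` with constant coefficients are solutions. Inverting `W` at
the base point makes the initial values arbitrary. -/
theorem exists_solution {C : Type*} [CommRing C] (hS : HasFundamentalMatrices δ) (κ : C →+* A)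
    (hκ : ∀ c, δ (κ c) = 0) (ev : A →+* C) (hev : ∀ c, ev (κ c) = c) {n m : ℕ} (hn : 1 ≤ n)
    (B : Fin n → Matrix (Fin m) (Fin m) A) (v : Fin n × Fin m → C) :
    ∃ w : Fin m → A, systemOp δ B w = 0 ∧
      ∀ (k : Fin n) (j : Fin m), ev (δ^[(k : ℕ)] (w j)) = v (k, j) := by
  obtain ⟨W, hW, hsol⟩ := exists_companion_solution hS hn B
  have hdet : IsUnit (W.map ev).det := by
    have := hW.map ev
    rwa [RingHom.map_det] at this
  set q := (W.map ev)⁻¹ *ᵥ v with hq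
  have hit : ∀ (k : ℕ) (j : Fin m), δ^[k] (∑ c, W (⟨0, hn⟩, j) c * κ (q c)) =
      ∑ c, δ^[k] (W (⟨0, hn⟩, j) c) * κ (q c) := by
    intro k j
    induction k with
    | zero => simp
    | succ k ih => simp [Function.iterate_succ_apply', ih, hκ, mul_comm]
  refine ⟨fun j => ∑ c, W (⟨0, hn⟩, j) c * κ (q c), ?_, fun k j => ?_⟩
  · ext i
    have h1 : systemOp δ B (fun j => ∑ c, W (⟨0, hn⟩, j) c * κ (q c)) i =
        ∑ c, systemOp δ B (fun j => W (⟨0, hn⟩, j) c) i * κ (q c) := by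
      simp only [systemOp, hit, add_mul, sum_add_distrib, Matrix.mulVec, dotProduct, mul_sum,
        sum_mul]
      congr 1
      rw [sum_comm (s := univ (α := Fin n × Fin m))]
      refine sum_congr rfl fun k _ => ?_
      rw [sum_comm]
      exact sum_congr rfl fun j _ => sum_congr rfl fun c _ => by ring
    rw [h1]
    exact sum_eq_zero fun c _ => by rw [(hsol c).1]; simp
  · rw [hit, map_sum]
    have h2 : (W.map ev *ᵥ q) (k, j) = v (k, j) := by
      rw [hq, Matrix.mulVec_mulVec, Matrix.mul_nonsing_inv _ hdet, Matrix.one_mulVec]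
    rw [← h2]
    simp only [Matrix.mulVec, dotProduct, Matrix.map_apply, map_mul, hev, (hsol _).2 k j]

/-- If `(u δ)ⁿ P` kills all solutions of a system, then it is a multiple of the operator of the
system. -/
theorem derivBy_iterate_eq_of_solutions (hS : HasFundamentalMatrices δ) {n m : ℕ} (hn : 1 ≤ n)
    {B : Fin n → Matrix (Fin m) (Fin m) A} {u : A} {P : Matrix (Fin m) (Fin m) A}
    (h : ∀ w, systemOp δ B w = 0 → ∀ i, (derivBy δ u)^[n] ((P *ᵥ w) i) = 0) (w : Fin m → A)
    (i : Fin m) :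
    (derivBy δ u)^[n] ((P *ᵥ w) i) = ((u ^ n • P) *ᵥ systemOp δ B w) i := by
  obtain ⟨W, hW, hsol⟩ := exists_companion_solution hS hn B
  -- `E` collects the coefficients of `(u δ)ⁿ P - uⁿ P L`, of order less than `n`. This operator
  -- kills the columns of `W`, so `E W = 0`, and `W` is invertible.
  let E : Matrix (Fin m) (Fin n × Fin m) A := Matrix.of fun i l =>
    (iterCoeff δ u P n l.1 - (u ^ n • P) * B l.1) i l.2
  have hE : E * W = 0 := by
    ext i c
    have h1 := derivBy_iterate_mulVec_eq δ u P B (fun j => W (⟨0, hn⟩, j) c) i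
    rw [h _ (hsol c).1, (hsol c).1] at h1
    simp only [Matrix.mulVec_zero, Pi.zero_apply, zero_add, (hsol c).2] at h1
    rw [Matrix.zero_apply, h1, Matrix.mul_apply, Fintype.sum_prod_type]
    rfl
  have hE0 : E = 0 := by
    have := congrArg (· * W⁻¹) hE
    simpa [Matrix.mul_assoc, Matrix.mul_nonsing_inv _ hW] using this
  refine operator_eq_of_iterCoeff_eq (fun k => sub_eq_zero.1 ?_) w i
  ext i j
  exact congrFun (congrFun hE0 i) (k, j)

/-- The interface to the two settings: linearising a point transformation only has to supply `u` and
`P`. -/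
theorem isIsotropicIterativeOver_of_solutions {t : A} (ht : δ t = 1)
    (hN : ∀ n : ℕ, n ≠ 0 → IsUnit (n : A)) (hS : HasFundamentalMatrices δ) {n m : ℕ} (hn : 1 ≤ n)
    {B N : Fin n → Matrix (Fin m) (Fin m) A} {Q : Matrix (Fin m) (Fin m) A}
    (hQ : IsNormalFormVia δ B N Q)
    {u : A} (hu : IsUnit u) {P : Matrix (Fin m) (Fin m) A} (hP : IsUnit P.det)
    (h : ∀ w, systemOp δ B w = 0 → ∀ i, (derivBy δ u)^[n] ((P *ᵥ w) i) = 0) :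
    IsIsotropicIterativeOver δ N := by
  refine isIsotropicIterativeOver_of_operator_eq ht hN hn hQ.1 hu (P := P * Q)
    (by rw [Matrix.det_mul]; exact hP.mul hQ.2.1) fun w i => ?_
  rw [← Matrix.mulVec_mulVec, derivBy_iterate_eq_of_solutions hS hn h, hQ.2.2,
    Matrix.mulVec_mulVec, Matrix.smul_mul]

/-- A solution of a first order system has no free slope and cannot be made transversal. But its
normal form is `w' = 0`, the case `Ψ = δ`. -/
theorem isIsotropicIterativeOver_of_order_one {m : ℕ} {N : Fin 1 → Matrix (Fin m) (Fin m) A}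
    (hN0 : ∀ k : Fin 1, (k : ℕ) + 1 = 1 → N k = 0) : IsIsotropicIterativeOver δ N :=
  ⟨0, by simp, fun k => by rw [hN0 k (by simp)]; simp, 1, 0, isUnit_one,
    fun y => by simp [psi, scalarOp]⟩

end Abstract

/-! ### Linearisation of a point transformation along a curve. -/

section Variation

variable {A A' : Type*} [CommRing A] [CommRing A'] {δ : Derivation ℤ A A}
  {δ' : Derivation ℤ A' A'}

/-- Think of `re` as restriction to `ε = 0` and of `im` as `∂/∂ε` there. Since `x` varies as well,
the variation of `dᵏy/dxᵏ` is the `k`-th derivative of the characteristic `im y - (dy/dx) im x` plus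
a transport term along the curve. The transport term vanishes on solutions when `k = n`. -/
theorem variation_derivBy_iterate (re : A' →+* A) (im : A' →+ A)
    (him : ∀ f g, im (f * g) = re f * im g + im f * re g)
    (hre : ∀ f, re (δ' f) = δ (re f)) (hδ : ∀ f, im (δ' f) = δ (im f)) {u x : A'}
    (hu : u * δ' x = 1) (y : A') (k : ℕ) :
    im ((derivBy δ' u)^[k] y) =
      (derivBy δ (re u))^[k] (im y - derivBy δ (re u) (re y) * im x) +
        (derivBy δ (re u))^[k + 1] (re y) * im x := by
  have h1 : ∀ k, re ((derivBy δ' u)^[k] y) = (derivBy δ (re u))^[k] (re y) :=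
    fun k => map_derivBy_iterate re hre u y k
  have hux : re u * δ (re x) = 1 := by rw [← hre, ← map_mul, hu, map_one]
  have h1' : im 1 = 0 := by simpa using him 1 1
  have hux' : re u * δ (im x) + im u * δ (re x) = 0 := by
    rw [← hδ, ← hre, ← him, hu, h1']
  -- The variation of `u = 1 / x'`.
  have hiu : im u = - re u ^ 2 * δ (im x) := by
    linear_combination re u * hux' - im u * hux
  induction k with
  | zero => simp
  | succ k ih =>
    rw [Function.iterate_succ_apply', Function.iterate_succ_apply',
      Function.iterate_succ_apply' _ (k + 1), derivBy, him, hδ, hre, ih, h1, hiu]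
    simp only [derivBy, map_add, Derivation.leibniz, smul_eq_mul, Function.iterate_succ_apply']
    ring

end Variation

/-- The linear part of a variation transversal to a curve is invertible if the Jacobian matrix of
the point transformation is. -/
theorem det_transversal_ne_zero {F : Type*} [Field F] {m : ℕ}
    {J : Matrix (Option (Fin m)) (Option (Fin m)) F} (hJ : J.det ≠ 0) (v y₁ : Fin m → F) (u : F)
    (hu : u * (J none none + ∑ j, J none (some j) * v j) = 1)
    (hy : ∀ i, y₁ i = J (some i) none + ∑ j, J (some i) (some j) * v j) :
    (Matrix.of fun i j => J (some i) (some j) - u * y₁ i * J none (some j)).det ≠ 0 := by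
  intro h
  obtain ⟨q, hq, hq0⟩ := Matrix.exists_mulVec_eq_zero_iff.2 h
  set c := u * ∑ j, J none (some j) * q j with hc
  have h1 : ∀ i, ∑ j, J (some i) (some j) * q j = y₁ i * c := by
    intro i
    have := congrFun hq0 i
    simp only [Matrix.mulVec, dotProduct, Matrix.of_apply, sub_mul, sum_sub_distrib,
      Pi.zero_apply] at this
    rw [sub_eq_zero.1 this, hc, mul_sum, mul_sum]
    exact sum_congr rfl fun j _ => by ring
  -- A kernel vector `q` gives `J (0, q) = c J (1, v)`, so `(0, q) - c (1, v)` lies in the kernel of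
  -- `J`.
  have h2 : J *ᵥ (fun o => o.elim (-c) fun j => q j - c * v j) = 0 := by
    ext o
    simp only [Matrix.mulVec, dotProduct, Fintype.sum_option, Option.elim, mul_sub,
      sum_sub_distrib, Pi.zero_apply]
    have h3 : ∀ o, ∑ j, J o (some j) * (c * v j) = c * ∑ j, J o (some j) * v j := by
      intro o
      rw [mul_sum]
      exact sum_congr rfl fun j _ => by ring
    rw [h3]
    cases o with
    | none =>
      rw [hc]
      linear_combination (-∑ j, J none (some j) * q j) * hu
    | some i =>
      rw [h1, hy]
      ring
  by_cases hz : (fun o : Option (Fin m) => o.elim (-c) fun j => q j - c * v j) = 0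
  · have hc0 : c = 0 := by simpa using congrFun hz none
    apply hq
    ext j
    simpa [hc0] using congrFun hz (some j)
  · exact hJ (Matrix.exists_mulVec_eq_zero_iff.1 ⟨_, hz, h2⟩)

/-- Otherwise `v = 0` and the unit vectors show that the row of `x` in `J` vanishes. -/
theorem exists_transversal {F : Type*} [Field F] {m : ℕ}
    {J : Matrix (Option (Fin m)) (Option (Fin m)) F} (hJ : J.det ≠ 0) :
    ∃ v : Fin m → F, J none none + ∑ j, J none (some j) * v j ≠ 0 := by
  by_contra! h
  have h0 : J none none = 0 := by simpa using h 0
  refine hJ (Matrix.det_eq_zero_of_row_eq_zero none fun o => ?_)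
  cases o with
  | none => exact h0
  | some j => simpa [h0, Pi.single_apply] using h (Pi.single j 1)

/-! ### The formal setting. -/

namespace Formal

open PowerSeries

universe u

/-- The derivative `d/dz` of formal power series as a derivation. -/
noncomputable def derivation (R : Type*) [CommRing R] : RingDerivation R⟦X⟧ :=
  ringDerivation (derivative R).toLinearMap.toAddMonoidHom (derivative R).leibniz

theorem coe_derivation (R : Type*) [CommRing R] : ⇑(derivation R) = D R := rfl

section Field

variable {K : Type u} [Field K]

theorem isUnit_natCast [CharZero K] (n : ℕ) (hn : n ≠ 0) : IsUnit (n : K⟦X⟧) := by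
  rw [PowerSeries.isUnit_iff_constantCoeff]
  simpa using hn

/-- Coefficients of the solution of `Q' = M Q` with `Q(0) = 1`. -/
noncomputable def fundamentalCoeff {ι : Type} [Fintype ι] [DecidableEq ι] (M : Matrix ι ι K⟦X⟧) :
    ℕ → Matrix ι ι K
  | 0 => 1
  | n + 1 => ((n : K) + 1)⁻¹ • ∑ k : Fin (n + 1), M.map (coeff (n - k)) * fundamentalCoeff M k

theorem hasFundamentalMatrices [CharZero K] : HasFundamentalMatrices (derivation K) := by
  intro ι _ _ M
  let Q : Matrix ι ι K⟦X⟧ := Matrix.of fun i j => PowerSeries.mk fun n => fundamentalCoeff M n i j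
  refine ⟨Q, ?_, ?_⟩
  · rw [PowerSeries.isUnit_iff_constantCoeff, RingHom.map_det]
    have : (constantCoeff (R := K)).mapMatrix Q = 1 := by
      ext i j
      simp only [RingHom.mapMatrix_apply, Matrix.map_apply, Q, Matrix.of_apply,
        ← coeff_zero_eq_constantCoeff_apply, coeff_mk, fundamentalCoeff]
    rw [this]; simp
  · ext i j n
    have hn : ((n : K) + 1) ≠ 0 := by exact_mod_cast n.succ_ne_zero
    have h1 : coeff n (derivation K (Q i j)) = coeff n (derivative K (Q i j)) := rfl
    rw [Matrix.map_apply, h1, coeff_derivative]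
    simp only [Q, Matrix.of_apply, coeff_mk, fundamentalCoeff]
    rw [Matrix.smul_apply, smul_eq_mul, mul_comm, mul_inv_cancel_left₀ hn, Matrix.sum_apply,
      Matrix.mul_apply, map_sum]
    simp only [Matrix.mul_apply, Matrix.map_apply, Matrix.of_apply]
    rw [sum_comm]
    refine sum_congr rfl fun l _ => ?_
    rw [coeff_mul, Finset.Nat.sum_antidiagonal_eq_sum_range_succ_mk, ← sum_range_reflect,
      ← Fin.sum_univ_eq_sum_range (fun k =>
        (coeff (n.succ - 1 - k, n - (n.succ - 1 - k)).1 (M i l)) *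
        (coeff (n.succ - 1 - k, n - (n.succ - 1 - k)).2) (mk fun n ↦ fundamentalCoeff M n l j))]
    refine sum_congr rfl fun k _ => ?_
    have : n - (n - k) = k := by omega
    simp [this]

/-! ### Chain rule -/

/-- A given coefficient of the substitution involves only finitely many coefficients of `g`. By
`h0`, the approximations `p n` bring in no further monomials, so agreement on those finitely many
suffices. -/
theorem eventually_coeff_subst_eq {σ R : Type*} [CommRing R] [Algebra K R]
    {a : σ → R⟦X⟧} (ha : MvPowerSeries.HasSubst a) {I : Type*} {l : Filter I}
    (g : MvPowerSeries σ K) (p : I → MvPowerSeries σ K)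
    (h0 : ∀ n d, (p n).coeff d = g.coeff d ∨ (p n).coeff d = 0)
    (h1 : ∀ d, ∀ᶠ n in l, (p n).coeff d = g.coeff d) (e : ℕ) :
    ∀ᶠ n in l, coeff e (MvPowerSeries.subst a (p n) : R⟦X⟧) =
      coeff e (MvPowerSeries.subst a g : R⟦X⟧) := by
  have hfin := MvPowerSeries.coeff_subst_finite ha g (Finsupp.single () e)
  have hev := (Filter.eventually_all_finite hfin).2 fun d _ => h1 d
  filter_upwards [hev] with n hn
  rw [PowerSeries.coeff, MvPowerSeries.coeff_subst ha, MvPowerSeries.coeff_subst ha]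
  refine finsum_congr fun d => ?_
  by_cases hd : d ∈ Function.support fun d => MvPowerSeries.coeff d g •
      (MvPowerSeries.coeff (Finsupp.single () e) (d.prod fun s e => (a s) ^ e))
  · rw [hn d hd]
  · rcases h0 n d with h | h
    · rw [h]
    · rw [h, zero_smul]
      exact (Function.notMem_support.1 hd).symm

end Field

variable {K : Type u} [Field K]

/-- The derivative of a truncation has the coefficients of the derivative or zeros, as
`eventually_coeff_subst_eq` demands. -/
theorem coeff_trunc_pderiv {σ : Type*} [DecidableEq σ] (f : MvPowerSeries σ K) (o : σ)
    (n d : σ →₀ ℕ) :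
    (MvPowerSeries.pderiv K o (MvPowerSeries.trunc K n f : MvPowerSeries σ K)).coeff d =
      if d + Finsupp.single o 1 < n then (MvPowerSeries.pderiv K o f).coeff d else 0 := by
  rw [MvPowerSeries.coeff_pderiv, MvPolynomial.coeff_coe, MvPowerSeries.coeff_trunc,
    MvPowerSeries.coeff_pderiv]
  split_ifs <;> simp

/-- Let `im` be a derivation along `re : R⟦X⟧ → K⟦X⟧` each of whose coefficients depends on finitely
many coefficients. Then `re` and `im` of the substitution of `a` into a power series are given by
substitution of `re a` and by the chain rule. -/
theorem map_subst_and_chain_rule {σ : Type} [Nonempty σ] [Fintype σ] {R : Type u}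
    [CommRing R] [Algebra K R] (ρ : R →ₐ[K] K) (im : R⟦X⟧ →+ K⟦X⟧)
    (him : ∀ f g, im (f * g) = PowerSeries.map (ρ : R →+* K) f * im g +
      im f * PowerSeries.map (ρ : R →+* K) g)
    (him0 : ∀ c : K, im (C (algebraMap K R c)) = 0)
    (hfin : ∀ e, ∃ e', ∀ f g : R⟦X⟧, coeff e' f = coeff e' g → coeff e (im f) = coeff e (im g))
    {a : σ → R⟦X⟧} (ha : ∀ s, IsNilpotent (constantCoeff (a s))) (f : MvPowerSeries σ K) :
    PowerSeries.map (ρ : R →+* K) (MvPowerSeries.subst a f : R⟦X⟧) =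
        (MvPowerSeries.subst (fun s => PowerSeries.map (ρ : R →+* K) (a s)) f : K⟦X⟧) ∧
      im (MvPowerSeries.subst a f : R⟦X⟧) =
        ∑ s, im (a s) * (MvPowerSeries.subst (fun s => PowerSeries.map (ρ : R →+* K) (a s))
          (MvPowerSeries.pderiv K s f) : K⟦X⟧) := by
  classical
  set re := PowerSeries.map (ρ : R →+* K) with hre
  have hsa : MvPowerSeries.HasSubst a := MvPowerSeries.hasSubst_of_constantCoeff_nilpotent ha
  have hsb : MvPowerSeries.HasSubst (fun s => re (a s)) :=
    MvPowerSeries.hasSubst_of_constantCoeff_nilpotent fun s => by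
      have := (ha s).map (ρ : R →+* K)
      change IsNilpotent (constantCoeff (re (a s)))
      rwa [← coeff_zero_eq_constantCoeff_apply, hre, PowerSeries.coeff_map,
        coeff_zero_eq_constantCoeff_apply]
  have hC : ∀ c : K, re (C (algebraMap K R c)) = C c := fun c => by simp [hre]
  have halg : ∀ c : K, algebraMap K R⟦X⟧ c = C (algebraMap K R c) := fun c => by
    rw [PowerSeries.algebraMap_apply]
  -- Both identities hold for polynomials by the Leibniz rule. They pass to power series one
  -- coefficient at a time, by truncation.
  have hpoly : ∀ p : MvPolynomial σ K,
      re (MvPolynomial.aeval a p) = MvPolynomial.aeval (fun s => re (a s)) p ∧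
      im (MvPolynomial.aeval a p) =
        ∑ s, im (a s) * MvPolynomial.aeval (fun s => re (a s)) (MvPolynomial.pderiv s p) := by
    intro p
    induction p using MvPolynomial.induction_on with
    | C c => simp [halg, hC, him0]
    | add p q hp hq => simp [hp.1, hq.1, hp.2, hq.2, mul_add, sum_add_distrib]
    | mul_X p o hp =>
      refine ⟨by simp [hp.1], ?_⟩
      rw [map_mul, him, hp.1, hp.2, MvPolynomial.aeval_X, sum_mul]
      simp only [MvPolynomial.pderiv_mul, MvPolynomial.pderiv_X, map_add, map_mul,
        MvPolynomial.aeval_X, mul_add, sum_add_distrib]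
      rw [add_comm]
      congr 1
      · exact sum_congr rfl fun s _ => by ring
      · rw [sum_eq_single o]
        · simp [mul_comm]
        · intro s _ hs
          simp [hs.symm]
        · simp
  -- Truncation keeps the exponents strictly below `n`; raising one exponent of `d`, which needs a
  -- variable, makes the inequality strict.
  have htr : ∀ d : σ →₀ ℕ, ∀ᶠ n in Filter.atTop, d < n := fun d => by
    filter_upwards [Filter.eventually_ge_atTop (d + Finsupp.single (Classical.arbitrary σ) 1)]
      with n hn
    exact lt_of_lt_of_le (lt_add_of_pos_right d (by simp [pos_iff_ne_zero])) hn
  have hf0 : ∀ n d, MvPowerSeries.coeff d (MvPowerSeries.trunc K n f : MvPowerSeries σ K) =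
      if d < n then f.coeff d else 0 := fun n d => by
    rw [MvPolynomial.coeff_coe, MvPowerSeries.coeff_trunc]
  have hA : ∀ {S : Type u} [CommRing S] [Algebra K S] {b : σ → S⟦X⟧},
      MvPowerSeries.HasSubst b → ∀ e, ∀ᶠ n in Filter.atTop,
      coeff e (MvPolynomial.aeval b (MvPowerSeries.trunc K n f) : S⟦X⟧) =
        coeff e (MvPowerSeries.subst b f : S⟦X⟧) := by
    intro S _ _ b hb e
    simp only [← MvPowerSeries.subst_coe]
    refine eventually_coeff_subst_eq hb f
      (fun n => (MvPowerSeries.trunc K n f : MvPowerSeries σ K)) (fun n d => ?_) (fun d => ?_) e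
    · rw [hf0]; split_ifs <;> simp
    · filter_upwards [htr d] with n hn
      rw [hf0, if_pos hn]
  have hB : ∀ s e, ∀ᶠ n in Filter.atTop,
      coeff e (MvPolynomial.aeval (fun s => re (a s))
        (MvPolynomial.pderiv s (MvPowerSeries.trunc K n f)) : K⟦X⟧) =
        coeff e (MvPowerSeries.subst (fun s => re (a s)) (MvPowerSeries.pderiv K s f) : K⟦X⟧) := by
    intro s e
    simp only [← MvPowerSeries.subst_coe, ← MvPowerSeries.pderiv_coe]
    refine eventually_coeff_subst_eq hsb _
      (fun n => MvPowerSeries.pderiv K s (MvPowerSeries.trunc K n f : MvPowerSeries σ K))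
      (fun n d => ?_) (fun d => ?_) e
    · rw [coeff_trunc_pderiv]; split_ifs <;> simp
    · filter_upwards [htr (d + Finsupp.single s 1)] with n hn
      rw [coeff_trunc_pderiv, if_pos hn]
  constructor
  · ext e
    obtain ⟨n, h1, h2⟩ := ((hA hsa e).and (hA hsb e)).exists
    rw [← h2, ← (hpoly _).1, hre, PowerSeries.coeff_map, PowerSeries.coeff_map, h1]
  · ext e
    obtain ⟨e', he'⟩ := hfin e
    -- The coefficient `e` of the products in the chain rule involves the coefficients up to `e` of
    -- the second factors.
    have hB' : ∀ᶠ n in Filter.atTop, ∀ s, ∀ e'' ∈ Set.Iic e,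
        coeff e'' (MvPolynomial.aeval (fun s => re (a s))
        (MvPolynomial.pderiv s (MvPowerSeries.trunc K n f)) : K⟦X⟧) =
        coeff e'' (MvPowerSeries.subst (fun s => re (a s)) (MvPowerSeries.pderiv K s f) : K⟦X⟧) :=
      Filter.eventually_all.2 fun s =>
        (Filter.eventually_all_finite (Set.finite_Iic e)).2 fun e'' _ => hB s e''
    obtain ⟨n, h1, h2⟩ := ((hA hsa e').and hB').exists
    rw [← he' _ _ h1, (hpoly _).2, map_sum, map_sum]
    refine sum_congr rfl fun s _ => ?_
    rw [coeff_mul, coeff_mul]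
    refine sum_congr rfl fun p hp => ?_
    rw [h2 s p.2 (by
      rw [HasAntidiagonal.mem_antidiagonal] at hp
      exact Set.mem_Iic.2 (by omega))]

/-- The coefficient of `ε`. -/
noncomputable def epsPart : (DualNumber K)⟦X⟧ →+ K⟦X⟧ where
  toFun f := PowerSeries.mk fun n => (coeff n f).snd
  map_zero' := by ext; simp
  map_add' f g := by ext; simp

theorem coeff_epsPart (f : (DualNumber K)⟦X⟧) (n : ℕ) : coeff n (epsPart f) = (coeff n f).snd := by
  simp [epsPart]

/-- The value at `ε = 0`. -/
noncomputable abbrev realPart : (DualNumber K)⟦X⟧ →+* K⟦X⟧ :=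
  PowerSeries.map ((TrivSqZeroExt.fstHom K K K : DualNumber K →ₐ[K] K) : DualNumber K →+* K)

theorem coeff_realPart (f : (DualNumber K)⟦X⟧) (n : ℕ) :
    coeff n (realPart f) = (coeff n f).fst := by
  simp [realPart]

theorem epsPart_mul (f g : (DualNumber K)⟦X⟧) :
    epsPart (f * g) = realPart f * epsPart g + epsPart f * realPart g := by
  ext n
  simp only [coeff_epsPart, coeff_mul, coeff_realPart, map_add, TrivSqZeroExt.snd_sum,
    ← sum_add_distrib]
  refine sum_congr rfl fun p _ => ?_
  simp [mul_comm]

theorem realPart_derivation (f : (DualNumber K)⟦X⟧) :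
    realPart (derivation (DualNumber K) f) = derivation K (realPart f) := by
  ext n
  simp only [coe_derivation, D, coeff_realPart, coeff_derivative]
  simp

theorem epsPart_derivation (f : (DualNumber K)⟦X⟧) :
    epsPart (derivation (DualNumber K) f) = derivation K (epsPart f) := by
  ext n
  simp only [coe_derivation, D, coeff_epsPart, coeff_derivative]
  simp [mul_comm]

theorem eq_zero_of_realPart_epsPart {f : (DualNumber K)⟦X⟧} (h1 : realPart f = 0)
    (h2 : epsPart f = 0) : f = 0 := by
  ext n
  · rw [← coeff_realPart, h1]; simp
  · rw [← coeff_epsPart, h2]; simp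

/-- Embedding of `K⟦X⟧` as the series constant in `ε`. -/
noncomputable abbrev lift : K⟦X⟧ →+* (DualNumber K)⟦X⟧ :=
  PowerSeries.map (algebraMap K (DualNumber K))

theorem realPart_lift (f : K⟦X⟧) : realPart (lift f) = f := by
  ext n; rw [coeff_realPart, coeff_map]; rfl

theorem epsPart_lift (f : K⟦X⟧) : epsPart (lift f) = 0 := by
  ext n; rw [coeff_epsPart, coeff_map]; rfl

theorem derivation_X (R : Type*) [CommRing R] : derivation R X = 1 := derivative_X

theorem derivation_C (c : K) : derivation K (C c) = 0 := derivative_C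

theorem derivation_map {R : Type*} [CommRing R] [Algebra K R] (f : K⟦X⟧) :
    PowerSeries.map (algebraMap K R) (derivation K f) =
      derivation R (PowerSeries.map (algebraMap K R) f) := by
  ext n
  simp [coe_derivation, D, coeff_derivative]

theorem isNormalForm_iff {n m : ℕ} {B N : Fin n → Matrix (Fin m) (Fin m) K⟦X⟧} :
    IsNormalForm B N ↔ ∃ Q, IsNormalFormVia (derivation K) B N Q :=
  ⟨fun ⟨h1, Q, h2, h3⟩ => ⟨Q, h1, h2, h3⟩, fun ⟨Q, h1, h2, h3⟩ => ⟨h1, Q, h2, h3⟩⟩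

theorem isIsotropicIterative_iff {n m : ℕ} {N : Fin n → Matrix (Fin m) (Fin m) K⟦X⟧} :
    IsIsotropicIterative N ↔ IsIsotropicIterativeOver (derivation K) N := Iff.rfl

/-! ### Formal point transformations along curves and their variations. -/

section Curve

variable {m : ℕ}

theorem hasSubst_curve {R : Type u} [CommRing R] {η : Fin m → R⟦X⟧}
    (hη : ∀ j, IsNilpotent (constantCoeff (η j))) (o : Option (Fin m)) :
    IsNilpotent (constantCoeff (o.elim X η : R⟦X⟧)) := by
  cases o with
  | none => simp
  | some j => exact hη j

/-- Partial derivatives of the components of a formal map along a curve. -/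
noncomputable def PointMap.partialAlong (Φ : PointMap K m) (η : Fin m → K⟦X⟧)
    (a o : Option (Fin m)) : K⟦X⟧ :=
  MvPowerSeries.subst (fun o : Option (Fin m) => (o.elim X η : K⟦X⟧))
    (MvPowerSeries.pderiv K o (Φ a))

theorem constantCoeff_partialAlong (Φ : PointMap K m) {η : Fin m → K⟦X⟧}
    (hη : ∀ j, constantCoeff (η j) = 0) (a o : Option (Fin m)) :
    constantCoeff (Φ.partialAlong η a o) = Φ.jacobian a o := by
  have hs : MvPowerSeries.HasSubst (fun o : Option (Fin m) => (o.elim X η : K⟦X⟧)) :=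
    MvPowerSeries.hasSubst_of_constantCoeff_nilpotent
      (hasSubst_curve fun j => by rw [hη j]; exact IsNilpotent.zero)
  set g := MvPowerSeries.pderiv K o (Φ a) with hg
  have h1 : g = MvPowerSeries.C (MvPowerSeries.constantCoeff g) +
      (g - MvPowerSeries.C (MvPowerSeries.constantCoeff g)) := by ring
  have h2 : MvPowerSeries.constantCoeff g = Φ.jacobian a o := by
    rw [hg, ← MvPowerSeries.coeff_zero_eq_constantCoeff_apply, MvPowerSeries.coeff_pderiv]
    simp [PointMap.jacobian]
  rw [PointMap.partialAlong, ← hg, h1, MvPowerSeries.subst_add hs, MvPowerSeries.subst_C, h2]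
  have h3 : MvPowerSeries.constantCoeff (MvPowerSeries.subst
      (fun o : Option (Fin m) => (o.elim X η : K⟦X⟧))
      (g - MvPowerSeries.C (Φ.jacobian a o)) : K⟦X⟧) = 0 := by
    refine MvPowerSeries.constantCoeff_subst_eq_zero hs (fun o => ?_) (by simp [h2])
    cases o with
    | none => exact constantCoeff_X
    | some j => exact hη j
  change MvPowerSeries.constantCoeff _ = _
  rw [map_add, h3]
  simp

theorem derivation_alongCurve (Φ : PointMap K m) {η : Fin m → K⟦X⟧}
    (hη : ∀ j, constantCoeff (η j) = 0) (a : Option (Fin m)) :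
    derivation K (Φ.alongCurve η a) = Φ.partialAlong η a none +
      ∑ j, derivation K (η j) * Φ.partialAlong η a (some j) := by
  have h := (map_subst_and_chain_rule (σ := Option (Fin m)) (AlgHom.id K K)
    (derivation K : K⟦X⟧ →+ K⟦X⟧)
    (fun f g => by simp [mul_comm]) (fun c => derivation_C c)
    -- Differentiation shifts the index: coefficient `e` of `f'` is determined by coefficient `e +
    -- 1` of `f`.
    (fun e => ⟨e + 1, fun f g h => by
      change coeff e (derivative K f) = coeff e (derivative K g)
      rw [coeff_derivative, coeff_derivative, h]⟩)
    (hasSubst_curve fun j => by rw [hη j]; exact IsNilpotent.zero) (Φ a)).2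
  have hid : ∀ f : K⟦X⟧, PowerSeries.map ((AlgHom.id K K : K →ₐ[K] K) : K →+* K) f = f := by
    intro f; ext; simp
  simp only [hid, Fintype.sum_option, Option.elim] at h
  have hX : (derivation K : K⟦X⟧ →+ K⟦X⟧) X = 1 := derivation_X K
  rw [hX, one_mul] at h
  exact h

/-- The curve is parametrised by `z`, which does not vary with `ε`; only the partial derivatives in
the dependent variables remain. -/
theorem alongCurve_variation (Φ : PointMap K m) {η : Fin m → (DualNumber K)⟦X⟧}
    (hη : ∀ j, IsNilpotent (constantCoeff (η j))) (a : Option (Fin m)) :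
    realPart (Φ.alongCurve η a) = Φ.alongCurve (fun j => realPart (η j)) a ∧
      epsPart (Φ.alongCurve η a) =
        ∑ j, epsPart (η j) * Φ.partialAlong (fun j => realPart (η j)) a (some j) := by
  have h := map_subst_and_chain_rule (σ := Option (Fin m)) (TrivSqZeroExt.fstHom K K K)
    epsPart epsPart_mul (fun c => by rw [← map_C]; exact epsPart_lift _)
    (fun e => ⟨e, fun f g h => by rw [coeff_epsPart, coeff_epsPart, h]⟩)
    (hasSubst_curve hη) (Φ a)
  have hcurve : (fun s : Option (Fin m) => realPart (s.elim X η)) =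
      fun s => s.elim X fun j => realPart (η j) := by
    ext1 s
    cases s with
    | none => exact map_X _
    | some j => rfl
  have hX : epsPart (X : (DualNumber K)⟦X⟧) = 0 := by
    rw [← map_X (algebraMap K (DualNumber K))]; exact epsPart_lift _
  rw [hcurve] at h
  refine ⟨h.1, h.2.trans ?_⟩
  rw [Fintype.sum_option]
  simp only [Option.elim, hX, zero_mul, zero_add]
  rfl

end Curve

theorem eps_systemOp {n m : ℕ} (B : Fin n → Matrix (Fin m) (Fin m) K⟦X⟧)
    (w : Fin m → (DualNumber K)⟦X⟧) (i : Fin m) :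
    epsPart (systemOp (D (DualNumber K)) (fun k => (B k).map lift) w i) =
      systemOp (D K) B (fun j => epsPart (w j)) i := by
  have hit : ∀ k (f : (DualNumber K)⟦X⟧),
      epsPart ((D (DualNumber K))^[k] f) = (D K)^[k] (epsPart f) :=
    fun k f => map_iterate_of_comm epsPart epsPart_derivation k f
  simp only [systemOp, map_add, map_sum, hit, Matrix.mulVec, dotProduct, Matrix.map_apply,
    epsPart_mul, epsPart_lift, realPart_lift, zero_mul, add_zero]

/-- Curves over the dual numbers detect the linearisation: `w + ε φ` is a solution over `K[ε]` for
all solutions `w` and `φ`, and the coefficient of `ε` of its image gives an equation for `φ`. -/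
theorem isIsotropicIterative_of_reducible [CharZero K] {n m : ℕ} (hn : 1 ≤ n)
    {B N : Fin n → Matrix (Fin m) (Fin m) K⟦X⟧} (hNF : IsNormalForm B N) (hR : Reducible B) :
    IsIsotropicIterative N := by
  obtain ⟨Q, hQ⟩ := isNormalForm_iff.1 hNF
  rw [isIsotropicIterative_iff]
  obtain rfl | hn2 := hn.eq_or_lt
  · exact isIsotropicIterativeOver_of_order_one hQ.1
  obtain ⟨w₀, Φ, hJ, hΦ⟩ := hR
  -- As `n ≥ 2`, a solution can start at the base point with a slope along which `x` is a
  -- coordinate. Its higher initial derivatives do not matter.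
  obtain ⟨v, hv⟩ := exists_transversal hJ
  obtain ⟨w, hw, hjet⟩ := exists_solution hasFundamentalMatrices C derivation_C
    (constantCoeff (R := K)) (fun c => by simp) hn B
    (fun q => if (q.1 : ℕ) = 0 then w₀ q.2 else v q.2)
  have hw0 : ∀ j, constantCoeff (w j) = w₀ j := fun j => by simpa using hjet ⟨0, hn⟩ j
  have hw1 : ∀ j, constantCoeff (derivation K (w j)) = v j := fun j => by
    simpa using hjet ⟨1, hn2⟩ j
  set η : Fin m → K⟦X⟧ := fun j => w j - C (w₀ j) with hη
  have hη0 : ∀ j, constantCoeff (η j) = 0 := fun j => by simp [hη, hw0]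
  have hη1 : ∀ j, constantCoeff (derivation K (η j)) = v j := fun j => by
    simp [hη, hw1, derivation_C]
  have hslope : ∀ a, constantCoeff (derivation K (Φ.alongCurve η a)) =
      Φ.jacobian a none + ∑ j, Φ.jacobian a (some j) * v j := by
    intro a
    rw [derivation_alongCurve Φ hη0, map_add, map_sum, constantCoeff_partialAlong Φ hη0]
    simp only [map_mul, hη1, constantCoeff_partialAlong Φ hη0, mul_comm]
  have hunit : IsUnit (derivation K (Φ.alongCurve η none)) := by
    rw [PowerSeries.isUnit_iff_constantCoeff, hslope]
    exact hv.isUnit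
  obtain ⟨u, hu⟩ := hunit.exists_left_inv
  -- `P φ` is the characteristic of the variation: the change of `y` in direction `φ`, corrected by
  -- `dy/dx` times the change of `x`.
  let P : Matrix (Fin m) (Fin m) K⟦X⟧ := Matrix.of fun i j => Φ.partialAlong η (some i) (some j) -
    u * derivation K (Φ.alongCurve η (some i)) * Φ.partialAlong η none (some j)
  have huu : IsUnit u := IsUnit.of_mul_eq_one _ hu
  have hP : IsUnit P.det := by
    rw [PowerSeries.isUnit_iff_constantCoeff, RingHom.map_det]
    refine IsUnit.mk0 _ ?_
    convert det_transversal_ne_zero hJ v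
      (fun i => constantCoeff (derivation K (Φ.alongCurve η (some i)))) (constantCoeff u) ?_ ?_
      using 2
    · ext i j
      simp [P, constantCoeff_partialAlong Φ hη0]
    · rw [← hslope, ← map_mul, hu, map_one]
    · exact fun i => hslope _
  refine isIsotropicIterativeOver_of_solutions (derivation_X K) isUnit_natCast
    hasFundamentalMatrices hn hQ huu hP fun φ hφ i => ?_
  -- the variation of the curve in the direction of `φ`
  let ε : (DualNumber K)⟦X⟧ := C DualNumber.eps
  have hεre : realPart ε = 0 := by simp [ε]
  have hεeps : epsPart ε = 1 := by
    ext n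
    simp only [coeff_epsPart, ε, coeff_C, coeff_one]
    split_ifs <;> simp
  let ηε : Fin m → (DualNumber K)⟦X⟧ := fun j => lift (η j) + ε * lift (φ j)
  have hre : (fun j => realPart (ηε j)) = η := by
    ext1 j; simp only [ηε, map_add, map_mul, hεre, realPart_lift]; simp
  have heps : ∀ j, epsPart (ηε j) = φ j := fun j => by
    simp only [ηε, map_add, epsPart_mul, hεre, hεeps, realPart_lift, epsPart_lift]; simp
  have hnil : ∀ j, IsNilpotent (constantCoeff (ηε j)) := by
    intro j
    refine ⟨2, ?_⟩
    have h1 : constantCoeff (ηε j) = DualNumber.eps * constantCoeff (lift (φ j)) := by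
      have h2 : constantCoeff (lift (η j)) = 0 := by
        rw [← coeff_zero_eq_constantCoeff_apply, coeff_map, coeff_zero_eq_constantCoeff_apply,
          hη0, map_zero]
      simp only [ηε, map_add, map_mul, h2, ε, constantCoeff_C, zero_add]
    rw [h1, mul_pow, pow_two, DualNumber.eps_mul_eps, zero_mul]
  have hreal : ∀ a, realPart (Φ.alongCurve ηε a) = Φ.alongCurve η a := fun a => by
    rw [(alongCurve_variation Φ hnil a).1, hre]
  have hunit' : IsUnit (derivation (DualNumber K) (Φ.alongCurve ηε none)) := by
    rw [PowerSeries.isUnit_iff_constantCoeff, TrivSqZeroExt.isUnit_iff_isUnit_fst,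
      ← coeff_zero_eq_constantCoeff_apply, ← coeff_realPart, realPart_derivation, hreal,
      coeff_zero_eq_constantCoeff_apply]
    exact (PowerSeries.isUnit_iff_constantCoeff.1 hunit)
  obtain ⟨u', hu'⟩ := hunit'.exists_left_inv
  have heps' : ∀ a, epsPart (Φ.alongCurve ηε a) = ∑ j, φ j * Φ.partialAlong η a (some j) :=
    fun a => by
      rw [(alongCurve_variation Φ hnil a).2, hre]; simp only [heps]
  have hreu : realPart u' = u := by
    have h1 := congrArg realPart hu'
    rw [map_mul, realPart_derivation, hreal, map_one] at h1
    exact hunit.mul_right_cancel (h1.trans hu.symm)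
  have hsol := (hΦ (DualNumber K) ηε hnil u' hu').1 (by
    ext1 i
    have hsum : ∀ j, C (algebraMap K (DualNumber K) (w₀ j)) + ηε j =
        lift (w j) + ε * lift (φ j) := by
      intro j
      simp only [ηε, hη, map_sub, map_C]; ring
    refine eq_zero_of_realPart_epsPart ?_ ?_
    · rw [map_systemOp (δ := D _) (δ' := D K) realPart realPart_derivation]
      have h1 : (fun k => ((B k).map lift).map realPart) = B := by
        ext1 k; ext1 a b; simp only [Matrix.map_apply, realPart_lift]
      simp only [hsum, map_add, map_mul, hεre, realPart_lift, zero_mul, add_zero]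
      rw [h1]
      exact congrFun hw i
    · rw [eps_systemOp]
      simp only [hsum, map_add, epsPart_mul, hεre, hεeps, realPart_lift, epsPart_lift, zero_mul,
        zero_add, one_mul]
      exact congrFun hφ i) i
  have hvar := variation_derivBy_iterate (δ := derivation K) (δ' := derivation (DualNumber K))
    realPart epsPart epsPart_mul realPart_derivation epsPart_derivation hu'
    (Φ.alongCurve ηε (some i)) n
  -- The image of the unperturbed solution satisfies the canonical equation, which removes the
  -- transport term.
  have hzero : (derivBy (derivation K) u)^[n] (Φ.alongCurve η (some i)) = 0 := by
    rw [← hreu, ← hreal, ← map_derivBy_iterate (δ := derivation _) (δ' := derivation K)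
      realPart realPart_derivation]
    exact (congrArg realPart hsol).trans (map_zero _)
  have hsol' : (derivBy (derivation (DualNumber K)) u')^[n] (Φ.alongCurve ηε (some i)) = 0 := hsol
  rw [hsol', map_zero, hreu, hreal, heps', heps', Function.iterate_succ_apply', hzero] at hvar
  have h0 : derivBy (derivation K) u 0 = 0 := by simp [derivBy]
  rw [h0, zero_mul, add_zero] at hvar
  rw [hvar]
  congr 1
  simp only [P, Matrix.mulVec, dotProduct, Matrix.of_apply, derivBy, mul_sum, ← sum_sub_distrib]
  exact sum_congr rfl fun j _ => by ring

theorem reducible_of_isIsotropicIterative [CharZero K] {n m : ℕ}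
    {B N : Fin n → Matrix (Fin m) (Fin m) K⟦X⟧} (hNF : IsNormalForm B N)
    (hI : IsIsotropicIterative N) : Reducible B := by
  obtain ⟨Q, hQ⟩ := isNormalForm_iff.1 hNF
  obtain ⟨r, P, hr, hP, hrP⟩ := exists_linear_canonical hasFundamentalMatrices hQ
    (isIsotropicIterative_iff.1 hI)
  -- The equivalence is required over every `K`-algebra `R`, so the operator identity over `K` is
  -- kept in terms of coefficients.
  have hcoeff := iterCoeff_eq_of_operator_eq (derivation_X K) isUnit_natCast hrP
  obtain ⟨s, hs⟩ := hr.exists_right_inv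
  -- A primitive of `s = 1 / r`. At `k = 0` division by zero gives the value 0, so `x` has no
  -- constant term.
  let x : K⟦X⟧ := PowerSeries.mk fun k => coeff (k - 1) s / k
  have hx : derivation K x = s := by
    ext k
    change coeff k (derivative K x) = _
    rw [coeff_derivative]
    have : (k : K) + 1 ≠ 0 := by exact_mod_cast k.succ_ne_zero
    simp [x]
    field_simp
  let emb : K⟦X⟧ → MvPowerSeries (Option (Fin m)) K := PowerSeries.subst (MvPowerSeries.X none)
  let Φ : PointMap K m := fun o => o.elim (emb x)
    fun i => ∑ j, emb (P i j) * MvPowerSeries.X (some j)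
  have hcurve : ∀ {R : Type u} [CommRing R] [Algebra K R] (η : Fin m → R⟦X⟧),
      (∀ j, IsNilpotent (constantCoeff (η j))) →
      Φ.alongCurve η none = PowerSeries.map (algebraMap K R) x ∧
      ∀ i, Φ.alongCurve η (some i) = ((P.map (PowerSeries.map (algebraMap K R))) *ᵥ η) i := by
    intro R _ _ η hη
    have hs : MvPowerSeries.HasSubst (fun o : Option (Fin m) => (o.elim X η : R⟦X⟧)) :=
      MvPowerSeries.hasSubst_of_constantCoeff_nilpotent (hasSubst_curve hη)
    have hemb : ∀ f : K⟦X⟧, (MvPowerSeries.subst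
        (fun o : Option (Fin m) => (o.elim X η : R⟦X⟧)) (emb f) : R⟦X⟧) =
        PowerSeries.map (algebraMap K R) f := by
      intro f
      have h1 : PowerSeries.HasSubst (MvPowerSeries.X none : MvPowerSeries (Option (Fin m)) K) :=
        PowerSeries.HasSubst.X _
      simp only [emb]
      rw [PowerSeries.subst_def, MvPowerSeries.subst_comp_subst_apply h1.const hs,
        MvPowerSeries.subst_X hs, PowerSeries.map_algebraMap_eq_subst_X]
      rfl
    refine ⟨hemb x, fun i => ?_⟩
    change MvPowerSeries.subst (fun o : Option (Fin m) => (o.elim X η : R⟦X⟧))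
      (∑ j, emb (P i j) * MvPowerSeries.X (some j)) = _
    rw [← MvPowerSeries.substAlgHom_apply hs, map_sum]
    simp only [map_mul, MvPowerSeries.substAlgHom_apply, hemb, MvPowerSeries.subst_X hs]
    rfl
  have hembd : ∀ f d, MvPowerSeries.coeff d (emb f) =
      if d = Finsupp.single none (d none) then coeff (d none) f else 0 :=
    fun f d => PowerSeries.coeff_subst_single none f d
  have hemb0 : ∀ f, MvPowerSeries.constantCoeff (emb f) = constantCoeff f := by
    intro f
    rw [← MvPowerSeries.coeff_zero_eq_constantCoeff_apply, hembd]
    simp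
  have hJx : ∀ o, Φ.jacobian none o = if o = none then constantCoeff s else 0 := by
    intro o
    have : Φ.jacobian none o = MvPowerSeries.coeff (Finsupp.single o 1) (emb x) := rfl
    rw [this, hembd]
    cases o with
    | none => simp [← hx, coe_derivation, D, ← coeff_zero_eq_constantCoeff_apply, coeff_derivative]
    | some j => simp [Finsupp.single_eq_zero]
  have hJy : ∀ i o, Φ.jacobian (some i) o =
      o.elim 0 fun j => constantCoeff (P i j) := by
    intro i o
    have h1 : Φ.jacobian (some i) o = MvPowerSeries.constantCoeff
        (MvPowerSeries.pderiv K o (∑ j, emb (P i j) * MvPowerSeries.X (some j))) := by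
      rw [← MvPowerSeries.coeff_zero_eq_constantCoeff_apply, MvPowerSeries.coeff_pderiv]
      simp [PointMap.jacobian, Φ]
    rw [h1, map_sum, map_sum]
    simp only [Derivation.leibniz, smul_eq_mul, map_add, map_mul, MvPowerSeries.constantCoeff_X,
      zero_mul, add_zero, hemb0]
    cases o with
    | none =>
      exact sum_eq_zero fun j _ => by
        rw [MvPowerSeries.pderiv_X_of_ne (by simp)]; simp
    | some j =>
      rw [sum_eq_single j]
      · simp
      · intro l _ hl
        rw [MvPowerSeries.pderiv_X_of_ne (by simpa using hl)]; simp
      · simp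
  refine ⟨0, Φ, ?_, ?_⟩
  -- At the base point `w = 0` the Jacobian is block diagonal, with blocks `s(0)` and `P(0)`.
  · intro hdet
    obtain ⟨q, hq, hq0⟩ := Matrix.exists_mulVec_eq_zero_iff.2 hdet
    have hs0 : constantCoeff s ≠ 0 := fun h => by
      have := congrArg constantCoeff hs
      rw [map_mul, h, mul_zero, map_one] at this
      exact zero_ne_one this
    have hP0 : ((constantCoeff (R := K)).mapMatrix P).det ≠ 0 := by
      rw [← RingHom.map_det]
      exact (PowerSeries.isUnit_iff_constantCoeff.1 hP).ne_zero
    have h1 : q none = 0 := by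
      have := congrFun hq0 none
      simp only [Matrix.mulVec, dotProduct, Fintype.sum_option, hJx] at this
      simpa [hs0] using this
    have h2 : (constantCoeff (R := K)).mapMatrix P *ᵥ (fun j => q (some j)) = 0 := by
      ext i
      have := congrFun hq0 (some i)
      simp only [Matrix.mulVec, dotProduct, Fintype.sum_option, hJy] at this
      simpa [Matrix.mulVec, dotProduct] using this
    have h3 := Matrix.eq_zero_of_mulVec_eq_zero hP0 h2
    apply hq
    ext o
    cases o with
    | none => exact h1
    | some j => exact congrFun h3 j
  · intro R _ _ η hη u hu
    set ι := PowerSeries.map (algebraMap K R) with hι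
    rw [(hcurve η hη).1] at hu
    have hu1 : u * ι s = 1 := by rw [← hx, hι, derivation_map]; exact hu
    have hu2 : u = ι r := by
      have : ι r * ι s = 1 := by rw [← map_mul, hs, map_one]
      linear_combination ι r * hu1 - u * this
    -- Over `R` the image satisfies `(d/dx)ⁿ y = rⁿ P L η` with `rⁿ P` invertible, so both sides of
    -- the equivalence say `L η = 0`.
    have hid := operator_eq_of_iterCoeff_eq (δ := derivation R) (u := ι r) (P := P.map ι)
      (B := fun k => (B k).map ι) (fun k => by
        rw [← map_iterCoeff ι derivation_map, hcoeff]
        ext1 i j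
        simp [Matrix.mul_apply, mul_sum, mul_assoc]) η
    simp only [Pi.zero_apply, map_zero, zero_add]
    have hdet : IsUnit (ι r ^ n • P.map ι).det := by
      have h1 : IsUnit (P.map ι).det := by
        have := hP.map ι
        rwa [RingHom.map_det] at this
      rw [Matrix.det_smul]
      exact (((hr.map ι).pow n).pow _).mul h1
    have hiff : (∀ i, (derivBy (D R) u)^[n] (Φ.alongCurve η (some i)) = 0) ↔
        (ι r ^ n • P.map ι) *ᵥ systemOp (D R) (fun k => (B k).map ι) η = 0 := by
      rw [funext_iff]
      refine forall_congr' fun i => ?_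
      rw [(hcurve η hη).2, hu2, Pi.zero_apply]
      exact Eq.congr_left (hid i)
    rw [hiff]
    constructor
    · intro h; erw [h]; simp
    · intro h
      have := congrArg ((ι r ^ n • P.map ι)⁻¹ *ᵥ ·) h
      simpa [Matrix.mulVec_mulVec, Matrix.nonsing_inv_mul _ hdet] using this

end Formal

open Filter

/-! ### Linear differential equations over `ℝ` and `ℂ` -/

section Existence

variable {𝕜 : Type*} [RCLike 𝕜] {V : Type*} [NormedAddCommGroup V] [NormedSpace 𝕜 V]

/-- Local solutions of linear differential equations, by successive approximation. -/
theorem exists_hasDerivAt_linear [CompleteSpace V] {z₀ : 𝕜} {M : 𝕜 → V →L[𝕜] V}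
    (hM : ∀ᶠ z in 𝓝 z₀, DifferentiableAt 𝕜 M z) (v : V) :
    ∃ y : 𝕜 → V, y z₀ = v ∧ ∀ᶠ z in 𝓝 z₀, HasDerivAt y (M z (y z)) z := by
  obtain ⟨R, hR, hMR⟩ := Metric.eventually_nhds_iff_ball.1 hM
  have hcont : ContinuousAt M z₀ := (hMR z₀ (Metric.mem_ball_self hR)).continuousAt
  set L := ‖M z₀‖ + 1 with hL
  have hLpos : 0 < L := by positivity
  obtain ⟨R', hR', hML⟩ := Metric.eventually_nhds_iff_ball.1
    (hcont.norm.eventually_lt_const (show ‖M z₀‖ < L by rw [hL]; linarith))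
  -- On a ball of radius at most `1 / (2 L)`, each integration of `M` against the previous term
  -- halves the bound.
  set ρ := min (min R R') (1 / (2 * L)) with hρ
  have hρpos : 0 < ρ := by positivity
  set U := Metric.ball z₀ ρ with hU
  have hz₀ : z₀ ∈ U := Metric.mem_ball_self hρpos
  have hMU : ∀ z ∈ U, DifferentiableAt 𝕜 M z := fun z hz =>
    hMR z (Metric.ball_subset_ball ((min_le_left _ _).trans (min_le_left _ _)) hz)
  have hLU : ∀ z ∈ U, ‖M z‖ ≤ L := fun z hz =>
    (hML z (Metric.ball_subset_ball ((min_le_left _ _).trans (min_le_right _ _)) hz)).le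
  have hconv : Convex ℝ U := convex_ball z₀ ρ
  have hopen : IsOpen U := Metric.isOpen_ball
  have hstep : ∀ d : {d : 𝕜 → V // DifferentiableOn 𝕜 d U}, ∃ d' : {d : 𝕜 → V //
      DifferentiableOn 𝕜 d U}, d'.1 z₀ = 0 ∧ ∀ z ∈ U, HasDerivAt d'.1 (M z (d.1 z)) z := by
    rintro ⟨d, hd⟩
    have h1 : DifferentiableOn 𝕜 (fun z => M z (d z)) U := fun z hz =>
      ((hMU z hz).differentiableWithinAt.clm_apply (hd z hz))
    obtain ⟨g, hg⟩ := hconv.exists_forall_hasDerivWithinAt h1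
    have hg' : ∀ z ∈ U, HasDerivAt (fun z => g z - g z₀) (M z (d z)) z := fun z hz =>
      ((hg z hz).hasDerivAt (hopen.mem_nhds hz)).sub_const _
    exact ⟨⟨fun z => g z - g z₀, fun z hz => (hg' z hz).differentiableAt.differentiableWithinAt⟩,
      by simp, hg'⟩
  choose step hstep0 hstep1 using hstep
  -- These are the increments of the successive approximations: `s 0 = v`, and `s (k + 1)` is the
  -- primitive of `M (s k)` vanishing at `z₀`. The solution is their sum.
  let s : ℕ → {d : 𝕜 → V // DifferentiableOn 𝕜 d U} := fun k =>
    Nat.rec ⟨fun _ => v, differentiableOn_const v⟩ (fun _ d => step d) k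
  have hs0 : (s 0).1 = fun _ => v := rfl
  have hsz : ∀ k, (s (k + 1)).1 z₀ = 0 := fun k => hstep0 (s k)
  have hsd : ∀ k, ∀ z ∈ U, HasDerivAt (s (k + 1)).1 (M z ((s k).1 z)) z := fun k => hstep1 (s k)
  have hbound : ∀ k, ∀ z ∈ U, ‖(s k).1 z‖ ≤ ‖v‖ * (1 / 2) ^ k := by
    intro k
    induction k with
    | zero => intro z _; simp [hs0]
    | succ k ih =>
      intro z hz
      have h1 := hconv.norm_image_sub_le_of_norm_hasDerivWithin_le (C := L * (‖v‖ * (1 / 2) ^ k))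
        (fun z hz => (hsd k z hz).hasDerivWithinAt)
        (fun z hz => ((M z).le_opNorm _).trans
          (mul_le_mul (hLU z hz) (ih z hz) (norm_nonneg _) hLpos.le)) hz₀ hz
      rw [hsz, sub_zero] at h1
      have h2 : ‖z - z₀‖ ≤ 1 / (2 * L) :=
        (mem_ball_iff_norm.1 hz).le.trans (min_le_right _ _)
      calc ‖(s (k + 1)).1 z‖ ≤ L * (‖v‖ * (1 / 2) ^ k) * ‖z - z₀‖ := h1
        _ ≤ L * (‖v‖ * (1 / 2) ^ k) * (1 / (2 * L)) := by gcongr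
        _ = ‖v‖ * (1 / 2) ^ (k + 1) := by field_simp; ring
  have hgeom : Summable fun k : ℕ => ‖v‖ * (1 / 2 : ℝ) ^ k :=
    (summable_geometric_of_lt_one (by norm_num) (by norm_num)).mul_left _
  have hsum : ∀ z ∈ U, Summable fun k => (s k).1 z := fun z hz =>
    hgeom.of_norm_bounded fun k => hbound k z hz
  have hsum1 : ∀ z ∈ U, Summable fun k => (s (k + 1)).1 z := fun z hz =>
    (summable_nat_add_iff 1).2 (hsum z hz)
  refine ⟨fun z => v + ∑' k, (s (k + 1)).1 z, by simp [hsz], ?_⟩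
  filter_upwards [hopen.mem_nhds hz₀] with z hz
  have h1 := hasDerivAt_tsum_of_isPreconnected (𝕜 := 𝕜) (g := fun k => (s (k + 1)).1)
    (g' := fun k z => M z ((s k).1 z)) (u := fun k => L * (‖v‖ * (1 / 2 : ℝ) ^ k))
    (hgeom.mul_left L) hopen hconv.isPreconnected hsd
    (fun k z hz => ((M z).le_opNorm _).trans
          (mul_le_mul (hLU z hz) (hbound k z hz) (norm_nonneg _) hLpos.le))
    hz₀ (hsum1 z₀ hz₀) hz
  have h2 := h1.const_add v
  convert h2 using 1
  rw [← (M z).map_tsum (hsum z hz), (hsum z hz).tsum_eq_zero_add, hs0]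

/-- Solutions of smooth linear differential equations are smooth. -/
theorem contDiffAt_of_hasDerivAt_linear {z₀ : 𝕜} {M : 𝕜 → V →L[𝕜] V}
    (hM : ∀ᶠ z in 𝓝 z₀, ContDiffAt 𝕜 ∞ M z) {y : 𝕜 → V}
    (hy : ∀ᶠ z in 𝓝 z₀, HasDerivAt y (M z (y z)) z) : ∀ᶠ z in 𝓝 z₀, ContDiffAt 𝕜 ∞ y z := by
  obtain ⟨R, hR, h⟩ := Metric.eventually_nhds_iff_ball.1 (hM.and hy)
  set U := Metric.ball z₀ R
  have hopen : IsOpen U := Metric.isOpen_ball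
  -- Bootstrapping: `y' = M y` has the regularity of `y`, so `y` gains one derivative at each step.
  have hn : ∀ n : ℕ, ContDiffOn 𝕜 n y U := by
    intro n
    induction n with
    | zero => exact contDiffOn_zero.2 fun z hz => (h z hz).2.continuousAt.continuousWithinAt
    | succ n ih =>
      push_cast
      rw [contDiffOn_succ_iff_deriv_of_isOpen hopen]
      refine ⟨fun z hz => (h z hz).2.differentiableAt.differentiableWithinAt,
        fun h => by simp at h, ?_⟩
      refine ContDiffOn.congr (f := fun z => M z (y z)) ?_ fun z hz => (h z hz).2.deriv
      exact ContDiffOn.clm_apply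
        (fun z hz => ((h z hz).1.of_le (by exact_mod_cast le_top)).contDiffWithinAt) ih
  filter_upwards [hopen.mem_nhds (Metric.mem_ball_self hR)] with z hz
  exact (contDiffOn_infty.2 hn).contDiffAt (hopen.mem_nhds hz)

end Existence

/-! ### Germs of smooth functions -/

section Germs

variable {𝕜 : Type*} [RCLike 𝕜] {E : Type*} [NormedAddCommGroup E] [NormedSpace 𝕜 E]

/-- `f` is smooth near `p`. -/
def SmoothAround (𝕜 : Type*) [RCLike 𝕜] {E : Type*} [NormedAddCommGroup E] [NormedSpace 𝕜 E]
    (p : E) (f : E → 𝕜) : Prop := ∀ᶠ q in 𝓝 p, ContDiffAt 𝕜 ∞ f q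

/-- Germs of smooth functions at `p`. -/
def SmoothGerm (𝕜 : Type*) [RCLike 𝕜] {E : Type*} [NormedAddCommGroup E] [NormedSpace 𝕜 E]
    (p : E) : Subring (Germ (𝓝 p) 𝕜) where
  carrier := {g | ∃ f : E → 𝕜, SmoothAround 𝕜 p f ∧ (f : Germ (𝓝 p) 𝕜) = g}
  mul_mem' := by
    rintro _ _ ⟨f, hf, rfl⟩ ⟨g, hg, rfl⟩
    exact ⟨f * g, (hf.and hg).mono fun q h => h.1.mul h.2, rfl⟩
  one_mem' := ⟨1, Eventually.of_forall fun q => contDiffAt_const, rfl⟩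
  add_mem' := by
    rintro _ _ ⟨f, hf, rfl⟩ ⟨g, hg, rfl⟩
    exact ⟨f + g, (hf.and hg).mono fun q h => h.1.add h.2, rfl⟩
  zero_mem' := ⟨0, Eventually.of_forall fun q => contDiffAt_const, rfl⟩
  neg_mem' := by
    rintro _ ⟨f, hf, rfl⟩
    exact ⟨-f, hf.mono fun q h => h.neg, rfl⟩

namespace SmoothGerm

variable {p : E}

/-- The germ of a smooth function. -/
def mk (f : E → 𝕜) (hf : SmoothAround 𝕜 p f) : SmoothGerm 𝕜 p := ⟨f, f, hf, rfl⟩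

theorem coe_mk (f : E → 𝕜) (hf : SmoothAround 𝕜 p f) :
    ((mk f hf : SmoothGerm 𝕜 p) : Germ (𝓝 p) 𝕜) = f := rfl

theorem mk_eq_mk {f g : E → 𝕜} {hf : SmoothAround 𝕜 p f} {hg : SmoothAround 𝕜 p g} :
    mk f hf = mk g hg ↔ f =ᶠ[𝓝 p] g :=
  Subtype.ext_iff.trans Germ.coe_eq

theorem exists_mk (a : SmoothGerm 𝕜 p) : ∃ f, ∃ hf : SmoothAround 𝕜 p f, mk f hf = a := by
  obtain ⟨_, f, hf, rfl⟩ := a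
  exact ⟨f, hf, rfl⟩

/-- Smoothness near `p` depends only on the germ. Smoothness of a composite expression thus follows
from membership of its germ in the subring. -/
theorem coe_mem_iff {f : E → 𝕜} : (f : Germ (𝓝 p) 𝕜) ∈ SmoothGerm 𝕜 p ↔ SmoothAround 𝕜 p f := by
  refine ⟨?_, fun hf => ⟨f, hf, rfl⟩⟩
  rintro ⟨g, hg, hgf⟩
  have h : g =ᶠ[𝓝 p] f := Germ.coe_eq.1 hgf
  filter_upwards [hg, h.eventually_nhds] with q hq hgq
  exact hq.congr_of_eventuallyEq (EventuallyEq.symm hgq)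

/-- A smooth representative. -/
noncomputable def rep (a : SmoothGerm 𝕜 p) : E → 𝕜 := (exists_mk a).choose

theorem smooth_rep (a : SmoothGerm 𝕜 p) : SmoothAround 𝕜 p (rep a) :=
  (exists_mk a).choose_spec.choose

theorem mk_rep (a : SmoothGerm 𝕜 p) : mk (rep a) (smooth_rep a) = a :=
  (exists_mk a).choose_spec.choose_spec

end SmoothGerm

theorem SmoothAround.comp {F : Type*} [NormedAddCommGroup F] [NormedSpace 𝕜 F]
    {g : F → E} {p : F} {f : E → 𝕜}
    (hf : SmoothAround 𝕜 (g p) f) (hg : ∀ᶠ q in 𝓝 p, ContDiffAt 𝕜 ∞ g q) :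
    SmoothAround 𝕜 p (fun q => f (g q)) := by
  filter_upwards [hg.self_of_nhds.continuousAt.eventually hf, hg] with q h1 h2
  exact ContDiffAt.comp q h1 h2

theorem SmoothAround.fderiv_apply {p : E} {f : E → 𝕜} (hf : SmoothAround 𝕜 p f) (v : E) :
    SmoothAround 𝕜 p fun q => fderiv 𝕜 f q v :=
  hf.mono fun q h => (h.fderiv_right (m := ∞) (by simp)).clm_apply contDiffAt_const

theorem SmoothAround.deriv {z₀ : 𝕜} {f : 𝕜 → 𝕜} (hf : SmoothAround 𝕜 z₀ f) :
    SmoothAround 𝕜 z₀ (deriv f) := hf.fderiv_apply 1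

/-- The directional derivative of germs of arbitrary functions. -/
noncomputable def germDeriv (𝕜 : Type*) [RCLike 𝕜] {E : Type*} [NormedAddCommGroup E]
    [NormedSpace 𝕜 E] (p v : E) : Germ (𝓝 p) 𝕜 → Germ (𝓝 p) 𝕜 :=
  Germ.map' (fun f q => fderiv 𝕜 f q v) fun f g (h : f =ᶠ[𝓝 p] g) =>
    (h.fderiv (𝕜 := 𝕜)).mono fun _ hq => congrArg (· v) hq

namespace SmoothGerm

variable {p : E}

/-- The directional derivative of germs of smooth functions. -/
noncomputable def dirDeriv (p v : E) : RingDerivation (SmoothGerm 𝕜 p) :=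
  ringDerivation (A := SmoothGerm 𝕜 p)
    { toFun := fun a => ⟨germDeriv 𝕜 p v a, by
        obtain ⟨_, f, hf, rfl⟩ := a
        exact ⟨_, hf.fderiv_apply v, rfl⟩⟩
      map_zero' := Subtype.ext (Germ.coe_eq.2 (Eventually.of_forall fun q =>
        congrArg (fun l : E →L[𝕜] 𝕜 => l v) (fderiv_const_apply (0 : 𝕜))))
      map_add' := by
        rintro ⟨_, f, hf, rfl⟩ ⟨_, g, hg, rfl⟩
        refine Subtype.ext (Germ.coe_eq.2 ?_)
        filter_upwards [hf, hg] with q hf hg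
        have := fderiv_add (hf.differentiableAt (by simp)) (hg.differentiableAt (by simp))
        exact (congrArg (· v) this) }
    (by
      rintro ⟨_, f, hf, rfl⟩ ⟨_, g, hg, rfl⟩
      refine Subtype.ext (Germ.coe_eq.2 ?_)
      filter_upwards [hf, hg] with q hf hg
      have := fderiv_mul (hf.differentiableAt (by simp)) (hg.differentiableAt (by simp))
      exact (congrArg (· v) this))

theorem dirDeriv_mk (p v : E) (f : E → 𝕜) (hf : SmoothAround 𝕜 p f) :
    dirDeriv p v (mk f hf) = mk (fun q => fderiv 𝕜 f q v) (hf.fderiv_apply v) := rfl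

theorem dirDeriv_comm (p v w : E) (a : SmoothGerm 𝕜 p) :
    dirDeriv p v (dirDeriv p w a) = dirDeriv p w (dirDeriv p v a) := by
  obtain ⟨f, hf, rfl⟩ := exists_mk a
  simp only [dirDeriv_mk]
  rw [mk_eq_mk]
  filter_upwards [hf] with q hq
  have hd : DifferentiableAt 𝕜 (fderiv 𝕜 f) q :=
    (hq.fderiv_right (m := ∞) (by simp)).differentiableAt (by simp)
  have h1 : ∀ w, fderiv 𝕜 (fun q => fderiv 𝕜 f q w) q = (fderiv 𝕜 (fderiv 𝕜 f) q).flip w := by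
    intro w
    rw [fderiv_clm_apply hd (differentiableAt_const w)]
    simp
  rw [h1, h1]
  exact hq.isSymmSndFDerivAt (by
    rw [minSmoothness_of_isRCLikeNormedField]
    exact (WithTop.coe_le_coe.2 (le_top : (2 : ℕ∞) ≤ ⊤))) v w

/-- The value of a germ at the base point. -/
noncomputable def eval (p : E) : SmoothGerm 𝕜 p →+* 𝕜 :=
  Germ.valueRingHom.comp (SmoothGerm 𝕜 p).subtype

theorem eval_mk (f : E → 𝕜) (hf : SmoothAround 𝕜 p f) : eval p (mk f hf) = f p := rfl

/-- Constant germs. -/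
noncomputable def const (p : E) : 𝕜 →+* SmoothGerm 𝕜 p where
  toFun c := mk (fun _ => c) (Eventually.of_forall fun _ => contDiffAt_const)
  map_zero' := rfl
  map_one' := rfl
  map_add' _ _ := rfl
  map_mul' _ _ := rfl

theorem dirDeriv_const (p v : E) (c : 𝕜) : dirDeriv p v (const p c) = 0 := by
  refine Subtype.ext (Germ.coe_eq.2 (Eventually.of_forall fun q => ?_))
  exact congrArg (fun l : E →L[𝕜] 𝕜 => l v) (fderiv_const_apply c)

theorem eval_const (p : E) (c : 𝕜) : eval p (const p c) = c := rfl

theorem isUnit_iff {a : SmoothGerm 𝕜 p} : IsUnit a ↔ eval p a ≠ 0 := by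
  refine ⟨fun h => (h.map (eval p)).ne_zero, fun h => ?_⟩
  obtain ⟨f, hf, rfl⟩ := exists_mk a
  have hne : ∀ᶠ q in 𝓝 p, f q ≠ 0 := hf.self_of_nhds.continuousAt.eventually_ne h
  refine IsUnit.of_mul_eq_one (mk (fun q => (f q)⁻¹) ((hf.and hne).mono fun q hq => hq.1.inv hq.2))
    (Subtype.ext (Germ.coe_eq.2 ?_))
  filter_upwards [hne] with q hq
  exact mul_inv_cancel₀ hq

theorem isUnit_natCast (n : ℕ) (hn : n ≠ 0) : IsUnit (n : SmoothGerm 𝕜 p) := by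
  rw [isUnit_iff, map_natCast]
  exact_mod_cast hn

section Line

variable {z₀ : 𝕜}

/-- The derivative `d/dz` of germs of smooth functions of one variable. -/
noncomputable def ddz (z₀ : 𝕜) : RingDerivation (SmoothGerm 𝕜 z₀) := dirDeriv z₀ 1

theorem ddz_mk (f : 𝕜 → 𝕜) (hf : SmoothAround 𝕜 z₀ f) :
    ddz z₀ (mk f hf) = mk (deriv f) hf.deriv := rfl

theorem ddz_const (c : 𝕜) : ddz z₀ (const z₀ c) = 0 := dirDeriv_const z₀ 1 c

theorem ddz_mk_id : ddz z₀ (mk (fun z => z) (Eventually.of_forall fun _ => contDiffAt_id)) = 1 := by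
  refine Subtype.ext (Germ.coe_eq.2 (Eventually.of_forall fun q => ?_))
  exact deriv_id q

/-- The columns are the solutions with the standard basis vectors as initial values, so the matrix
is the identity at `z₀` and its determinant is a unit. -/
theorem hasFundamentalMatrices (z₀ : 𝕜) : HasFundamentalMatrices (ddz z₀) := by
  intro ι _ _ M
  let A : 𝕜 → (ι → 𝕜) →L[𝕜] (ι → 𝕜) := fun z => ∑ i, ∑ j, rep (M i j) z •
    (ContinuousLinearMap.proj j : (ι → 𝕜) →L[𝕜] 𝕜).smulRight (Pi.single i 1 : ι → 𝕜)
  have hAv : ∀ z v i, A z v i = ∑ j, rep (M i j) z * v j := by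
    intro z v i
    simp [A, Finset.sum_apply, Pi.single_apply]
  have hA : ∀ᶠ z in 𝓝 z₀, ContDiffAt 𝕜 ∞ A z := by
    have h : ∀ᶠ z in 𝓝 z₀, ∀ i j, ContDiffAt 𝕜 ∞ (rep (M i j)) z :=
      eventually_all.2 fun i => eventually_all.2 fun j => smooth_rep (M i j)
    filter_upwards [h] with z hz
    exact ContDiffAt.sum fun i _ => ContDiffAt.sum fun j _ => (hz i j).smul contDiffAt_const
  choose y hy0 hy using fun c : ι => exists_hasDerivAt_linear
    (hA.mono fun z hz => hz.differentiableAt (by simp)) (Pi.single c 1 : ι → 𝕜)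
  have hsmooth : ∀ i c, SmoothAround 𝕜 z₀ fun z => y c z i := fun i c =>
    (contDiffAt_of_hasDerivAt_linear hA (hy c)).mono fun z hz => contDiffAt_pi.1 hz i
  refine ⟨Matrix.of fun i c => mk (fun z => y c z i) (hsmooth i c), ?_, ?_⟩
  · rw [isUnit_iff, RingHom.map_det]
    have : (eval z₀).mapMatrix (Matrix.of fun i c => mk (fun z => y c z i) (hsmooth i c)) = 1 := by
      ext i c
      rw [RingHom.mapMatrix_apply, Matrix.map_apply, Matrix.of_apply, eval_mk, hy0,
        Matrix.one_apply, Pi.single_apply]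
    rw [this]
    simp
  · ext1 i c
    rw [Matrix.map_apply, Matrix.mul_apply]
    have h1 : ∀ j, M i j = mk (rep (M i j)) (smooth_rep _) := fun j => (mk_rep _).symm
    apply Subtype.ext
    simp only [Matrix.of_apply]
    have h2 : (((∑ j, M i j * mk (fun z => y c z j) (hsmooth j c) : SmoothGerm 𝕜 z₀)) :
        Germ (𝓝 z₀) 𝕜) = ((fun z => ∑ j, rep (M i j) z * y c z j : 𝕜 → 𝕜) : Germ (𝓝 z₀) 𝕜) := by
      have h3 : (fun z => ∑ j, rep (M i j) z * y c z j : 𝕜 → 𝕜) =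
          ∑ j, rep (M i j) * fun z => y c z j := by
        ext z; simp
      rw [h3, ← Germ.coe_coeRingHom, map_sum, AddSubmonoidClass.coe_finsetSum]
      refine sum_congr rfl fun j _ => ?_
      conv_lhs => rw [h1 j]
      rfl
    rw [h2, ddz_mk, coe_mk]
    refine Germ.coe_eq.2 ?_
    filter_upwards [hy c] with z hz
    have h4 := (hasDerivAt_pi.1 hz i).deriv
    rw [hAv] at h4
    exact h4

/-- Functions with `deriv` and smooth germs with `ddz` both map to germs of arbitrary functions with
`germDeriv`; the two images are compared there. -/
theorem coe_systemOp {n m : ℕ} {B : Fin n → Matrix (Fin m) (Fin m) (𝕜 → 𝕜)} {w : Fin m → 𝕜 → 𝕜}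
    (hB : ∀ k i j, SmoothAround 𝕜 z₀ (B k i j)) (hw : ∀ j, SmoothAround 𝕜 z₀ (w j)) (i : Fin m) :
    ((systemOp deriv B w i : 𝕜 → 𝕜) : Germ (𝓝 z₀) 𝕜) =
      (systemOp (ddz z₀) (fun k => Matrix.of fun i j => mk (B k i j) (hB k i j))
        (fun j => mk (w j) (hw j)) i : SmoothGerm 𝕜 z₀) := by
  have h1 := map_systemOp (δ := deriv) (δ' := germDeriv 𝕜 z₀ 1) (Germ.coeRingHom (𝓝 z₀))
    (fun f => rfl) B w i
  have h2 := map_systemOp (δ := ddz z₀) (δ' := germDeriv 𝕜 z₀ 1)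
    (SmoothGerm 𝕜 z₀).subtype (fun f => rfl)
    (fun k => Matrix.of fun i j => mk (B k i j) (hB k i j)) (fun j => mk (w j) (hw j)) i
  exact h1.trans h2.symm

theorem coe_mulVec {m : ℕ} {Q : Matrix (Fin m) (Fin m) (𝕜 → 𝕜)} {w : Fin m → 𝕜 → 𝕜}
    (hQ : ∀ i j, SmoothAround 𝕜 z₀ (Q i j)) (hw : ∀ j, SmoothAround 𝕜 z₀ (w j)) (i : Fin m) :
    (((Q *ᵥ w) i : 𝕜 → 𝕜) : Germ (𝓝 z₀) 𝕜) =
      (((Matrix.of fun i j => mk (Q i j) (hQ i j)) *ᵥ fun j => mk (w j) (hw j)) i :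
        SmoothGerm 𝕜 z₀) :=
  (map_mulVec (Germ.coeRingHom (𝓝 z₀)) Q w i).trans
    (map_mulVec (SmoothGerm 𝕜 z₀).subtype (Matrix.of fun i j => mk (Q i j) (hQ i j))
      (fun j => mk (w j) (hw j)) i).symm

end Line

end SmoothGerm

end Germs

/-! ### Translation between functions near `z₀` and germs; sufficiency in the smooth setting. -/

section Smooth

variable {𝕜 : Type*} [RCLike 𝕜] {z₀ : 𝕜} {n m : ℕ}

open SmoothGerm

/-- The matrix of germs of a matrix of smooth functions. -/
def germMatrix (Q : Matrix (Fin m) (Fin m) (𝕜 → 𝕜)) (hQ : ∀ i j, SmoothNear z₀ (Q i j)) :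
    Matrix (Fin m) (Fin m) (SmoothGerm 𝕜 z₀) :=
  Matrix.of fun i j => mk (Q i j) (hQ i j)

theorem germMatrix_map_subtype (Q : Matrix (Fin m) (Fin m) (𝕜 → 𝕜))
    (hQ : ∀ i j, SmoothNear z₀ (Q i j)) :
    (germMatrix Q hQ).map (SmoothGerm 𝕜 z₀).subtype = Q.map (Germ.coeRingHom (𝓝 z₀)) := rfl

theorem exists_germMatrix (M : Matrix (Fin m) (Fin m) (SmoothGerm 𝕜 z₀)) :
    ∃ Q, ∃ hQ : ∀ i j, SmoothNear z₀ (Q i j), germMatrix Q hQ = M :=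
  ⟨Matrix.of fun i j => rep (M i j), fun i j => smooth_rep (M i j), by
    ext1 i j; exact mk_rep (M i j)⟩

theorem exists_germ_vector (v : Fin m → SmoothGerm 𝕜 z₀) :
    ∃ w : Fin m → 𝕜 → 𝕜, ∃ hw : ∀ j, SmoothNear z₀ (w j), (fun j => mk (w j) (hw j)) = v :=
  ⟨fun j => rep (v j), fun j => smooth_rep (v j), by ext1 j; exact mk_rep (v j)⟩

theorem smoothNear_mulVec {Q : Matrix (Fin m) (Fin m) (𝕜 → 𝕜)} {w : Fin m → 𝕜 → 𝕜}
    (hQ : ∀ i j, SmoothNear z₀ (Q i j)) (hw : ∀ j, SmoothNear z₀ (w j)) (i : Fin m) :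
    SmoothNear z₀ ((Q *ᵥ w) i) :=
  coe_mem_iff.1 (by rw [coe_mulVec hQ hw]; exact Subtype.property _)

theorem mk_mulVec {Q : Matrix (Fin m) (Fin m) (𝕜 → 𝕜)} {w : Fin m → 𝕜 → 𝕜}
    (hQ : ∀ i j, SmoothNear z₀ (Q i j)) (hw : ∀ j, SmoothNear z₀ (w j)) :
    (fun i => mk ((Q *ᵥ w) i) (smoothNear_mulVec hQ hw i)) =
      germMatrix Q hQ *ᵥ fun j => mk (w j) (hw j) := by
  ext1 i
  exact Subtype.ext (coe_mulVec hQ hw i)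

theorem smoothNear_systemOp {B : Fin n → Matrix (Fin m) (Fin m) (𝕜 → 𝕜)} {w : Fin m → 𝕜 → 𝕜}
    (hB : ∀ k i j, SmoothNear z₀ (B k i j)) (hw : ∀ j, SmoothNear z₀ (w j)) (i : Fin m) :
    SmoothNear z₀ (systemOp deriv B w i) :=
  coe_mem_iff.1 (by rw [coe_systemOp hB hw]; exact Subtype.property _)

theorem mk_systemOp {B : Fin n → Matrix (Fin m) (Fin m) (𝕜 → 𝕜)} {w : Fin m → 𝕜 → 𝕜}
    (hB : ∀ k i j, SmoothNear z₀ (B k i j)) (hw : ∀ j, SmoothNear z₀ (w j)) :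
    (fun i => mk (systemOp deriv B w i) (smoothNear_systemOp hB hw i)) =
      systemOp (ddz z₀) (fun k => germMatrix (B k) (hB k)) fun j => mk (w j) (hw j) := by
  ext1 i
  exact Subtype.ext (coe_systemOp hB hw i)

theorem mk_zero_iff {f : 𝕜 → 𝕜} (hf : SmoothNear z₀ f) :
    (mk f hf : SmoothGerm 𝕜 z₀) = 0 ↔ f =ᶠ[𝓝 z₀] 0 :=
  Subtype.ext_iff.trans Germ.coe_eq

theorem isUnit_det_germMatrix {Q : Matrix (Fin m) (Fin m) (𝕜 → 𝕜)}
    (hQ : ∀ i j, SmoothNear z₀ (Q i j)) : IsUnit (germMatrix Q hQ).det ↔ Q.det z₀ ≠ 0 := by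
  have h1 : eval z₀ (germMatrix Q hQ).det = Q.det z₀ := by
    rw [RingHom.map_det]
    exact (RingHom.map_det (Pi.evalRingHom (fun _ : 𝕜 => 𝕜) z₀) Q).symm
  rw [SmoothGerm.isUnit_iff, h1]

/-- Every smooth germ has a smooth representative, so testing on functions near `z₀` is the same as
testing on germs. -/
theorem isNormalForm_iff {B N : Fin n → Matrix (Fin m) (Fin m) (𝕜 → 𝕜)}
    (hB : ∀ k i j, SmoothNear z₀ (B k i j)) :
    IsNormalForm z₀ B N ↔ ∃ (hN : ∀ k i j, SmoothNear z₀ (N k i j))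
      (Q : Matrix (Fin m) (Fin m) (SmoothGerm 𝕜 z₀)),
      IsNormalFormVia (ddz z₀) (fun k => germMatrix (B k) (hB k))
        (fun k => germMatrix (N k) (hN k)) Q := by
  have key : ∀ (hN : ∀ k i j, SmoothNear z₀ (N k i j)) (Q : Matrix (Fin m) (Fin m) (𝕜 → 𝕜))
      (hQ : ∀ i j, SmoothNear z₀ (Q i j)) (w : Fin m → 𝕜 → 𝕜) (hw : ∀ j, SmoothNear z₀ (w j)),
      (∀ i, systemOp deriv B (Q *ᵥ w) i =ᶠ[𝓝 z₀] (Q *ᵥ systemOp deriv N w) i) ↔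
      systemOp (ddz z₀) (fun k => germMatrix (B k) (hB k))
        (germMatrix Q hQ *ᵥ fun j => mk (w j) (hw j)) =
      germMatrix Q hQ *ᵥ systemOp (ddz z₀) (fun k => germMatrix (N k) (hN k))
        (fun j => mk (w j) (hw j)) := by
    intro hN Q hQ w hw
    rw [← mk_mulVec hQ hw, ← mk_systemOp hB (smoothNear_mulVec hQ hw), ← mk_systemOp hN hw,
      ← mk_mulVec hQ (smoothNear_systemOp hN hw), funext_iff]
    exact forall_congr' fun i => mk_eq_mk.symm
  constructor
  · rintro ⟨hN, hN0, Q, hQ, hdet, h⟩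
    refine ⟨hN, germMatrix Q hQ, fun k hk => ?_, (isUnit_det_germMatrix hQ).2 hdet, fun v => ?_⟩
    · ext1 i j
      exact (mk_zero_iff (hN k i j)).2 (hN0 k hk i j)
    · obtain ⟨w, hw, rfl⟩ := exists_germ_vector v
      exact (key hN Q hQ w hw).1 (h w hw)
  · rintro ⟨hN, M, hN0, hdet, h⟩
    obtain ⟨Q, hQ, rfl⟩ := exists_germMatrix M
    refine ⟨hN, fun k hk i j => ?_, Q, hQ, (isUnit_det_germMatrix hQ).1 hdet, fun w hw => ?_⟩
    · exact (mk_zero_iff (hN k i j)).1 (congrFun (congrFun (hN0 k hk) i) j)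
    · exact (key hN Q hQ w hw).2 (h _)

theorem exists_isNormalForm (hn : 1 ≤ n) {B : Fin n → Matrix (Fin m) (Fin m) (𝕜 → 𝕜)}
    (hB : ∀ k i j, SmoothNear z₀ (B k i j)) : ∃ N, IsNormalForm z₀ B N := by
  obtain ⟨N', Q, h⟩ := exists_isNormalFormVia SmoothGerm.isUnit_natCast
    (SmoothGerm.hasFundamentalMatrices z₀) hn fun k => germMatrix (B k) (hB k)
  choose N hN hNN' using fun k => exists_germMatrix (N' k)
  refine ⟨N, (isNormalForm_iff hB).2 ⟨hN, Q, ?_⟩⟩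
  convert h using 1
  exact funext hNN'

theorem isIsotropicIterative_iff {N : Fin n → Matrix (Fin m) (Fin m) (𝕜 → 𝕜)}
    (hN : ∀ k i j, SmoothNear z₀ (N k i j)) :
    IsIsotropicIterative z₀ N ↔
      IsIsotropicIterativeOver (ddz z₀) fun k => germMatrix (N k) (hN k) := by
  have key : ∀ (a : Fin n → 𝕜 → 𝕜) (ha : ∀ k, SmoothNear z₀ (a k)) (r s y : 𝕜 → 𝕜)
      (hr : SmoothNear z₀ r) (hs : SmoothNear z₀ s) (hy : SmoothNear z₀ y),
      (psi deriv r s)^[n] y =ᶠ[𝓝 z₀] r ^ n * scalarOp deriv a y ↔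
      (psi (ddz z₀) (mk r hr) (mk s hs))^[n] (mk y hy) =
        mk r hr ^ n * scalarOp (ddz z₀) (fun k => mk (a k) (ha k)) (mk y hy) := by
    intro a ha r s y hr hs hy
    have hc : ∀ f : 𝕜 → 𝕜, Germ.coeRingHom (𝓝 z₀) (deriv f) =
      germDeriv 𝕜 z₀ 1 (Germ.coeRingHom (𝓝 z₀) f) := fun f => rfl
    have hc' : ∀ f : SmoothGerm 𝕜 z₀, (SmoothGerm 𝕜 z₀).subtype (ddz z₀ f) =
      germDeriv 𝕜 z₀ 1 ((SmoothGerm 𝕜 z₀).subtype f) := fun f => rfl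
    have h1 := map_psi_iterate (Germ.coeRingHom (𝓝 z₀)) hc r s y n
    have h2 := map_psi_iterate (SmoothGerm 𝕜 z₀).subtype hc' (mk r hr) (mk s hs) (mk y hy) n
    have h3 := map_scalarOp (Germ.coeRingHom (𝓝 z₀)) hc a y
    have h4 := map_scalarOp (SmoothGerm 𝕜 z₀).subtype hc' (fun k => mk (a k) (ha k)) (mk y hy)
    rw [← Germ.coe_eq, Subtype.ext_iff]
    have h5 : ((r ^ n * scalarOp deriv a y : 𝕜 → 𝕜) : Germ (𝓝 z₀) 𝕜) =
        (mk r hr ^ n * scalarOp (ddz z₀) (fun k => mk (a k) (ha k)) (mk y hy) :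
          SmoothGerm 𝕜 z₀) := by
      rw [Germ.coe_mul, Germ.coe_pow]
      exact congrArg ((r : Germ (𝓝 z₀) 𝕜) ^ n * ·) (h3.trans h4.symm)
    rw [h5]
    exact Eq.congr_left (h1.trans h2.symm)
  have keyN : ∀ (a : Fin n → 𝕜 → 𝕜) (ha : ∀ k, SmoothNear z₀ (a k)) k,
      (∀ i j, N k i j =ᶠ[𝓝 z₀] (a k • (1 : Matrix (Fin m) (Fin m) (𝕜 → 𝕜))) i j) ↔
      germMatrix (N k) (hN k) = mk (a k) (ha k) • 1 := by
    intro a ha k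
    rw [← Matrix.ext_iff]
    refine forall_congr' fun i => forall_congr' fun j => ?_
    rw [← Germ.coe_eq, Subtype.ext_iff]
    have : ((a k • (1 : Matrix (Fin m) (Fin m) (𝕜 → 𝕜))) i j : Germ (𝓝 z₀) 𝕜) =
        ((mk (a k) (ha k) • (1 : Matrix (Fin m) (Fin m) (SmoothGerm 𝕜 z₀))) i j :
          SmoothGerm 𝕜 z₀) := by
      by_cases hij : i = j
      · subst hij; simp; rfl
      · simp [Matrix.one_apply_ne hij]
    rw [this]
    rfl
  constructor
  · rintro ⟨a, ha, ha0, hNa, r, s, hr, hs, hr0, h⟩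
    refine ⟨fun k => mk (a k) (ha k), fun k hk => (mk_zero_iff _).2 (ha0 k hk),
      fun k => (keyN a ha k).1 (hNa k), mk r hr, mk s hs, SmoothGerm.isUnit_iff.2 hr0, fun y => ?_⟩
    obtain ⟨y, hy, rfl⟩ := exists_mk y
    exact (key a ha r s y hr hs hy).1 (h y hy)
  · rintro ⟨a', ha0, hNa, r', s', hr0, h⟩
    choose a ha haa' using fun k => exists_mk (a' k)
    obtain rfl : (fun k => mk (a k) (ha k)) = a' := funext haa'
    obtain ⟨r, hr, rfl⟩ := exists_mk r'
    obtain ⟨s, hs, rfl⟩ := exists_mk s'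
    exact ⟨a, ha, fun k hk => (mk_zero_iff _).1 (ha0 k hk), fun k => (keyN a ha k).2 (hNa k),
      r, s, hr, hs, SmoothGerm.isUnit_iff.1 hr0, fun y hy => (key a ha r s y hr hs hy).2 (h _)⟩

theorem exists_primitive {f : 𝕜 → 𝕜} (hf : SmoothNear z₀ f) :
    ∃ x, SmoothNear z₀ x ∧ deriv x =ᶠ[𝓝 z₀] f := by
  obtain ⟨R, hR, h⟩ := Metric.eventually_nhds_iff_ball.1 hf
  set U := Metric.ball z₀ R
  have hopen : IsOpen U := Metric.isOpen_ball
  obtain ⟨x, hx⟩ := (convex_ball z₀ R).exists_forall_hasDerivWithinAt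
    fun z hz => ((h z hz).differentiableAt (by simp)).differentiableWithinAt
  have hx' : ∀ z ∈ U, HasDerivAt x (f z) z := fun z hz => (hx z hz).hasDerivAt (hopen.mem_nhds hz)
  have hmem : U ∈ 𝓝 z₀ := hopen.mem_nhds (Metric.mem_ball_self hR)
  have hsm : ContDiffOn 𝕜 ∞ x U := (contDiffOn_infty_iff_deriv_of_isOpen hopen).2
    ⟨fun z hz => (hx' z hz).differentiableAt.differentiableWithinAt,
      ContDiffOn.congr (fun z hz => (h z hz).contDiffWithinAt) fun z hz => (hx' z hz).deriv⟩
  exact ⟨x, mem_of_superset hmem fun z hz => hsm.contDiffAt (hopen.mem_nhds hz),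
    mem_of_superset hmem fun z hz => (hx' z hz).deriv⟩

theorem smoothNear_eventually {f : 𝕜 → 𝕜} (hf : SmoothNear z₀ f) : ∀ᶠ z in 𝓝 z₀, SmoothNear z f :=
  eventually_eventually_nhds.2 hf

/-- Stated for functions, the identity at `z₀` persists at nearby points `z₁`, where it becomes an
identity of germs again. Curves in the domain of the transformation live at such points. -/
theorem iterCoeff_germ_iff {r : 𝕜 → 𝕜} (hr : SmoothNear z₀ r)
    {P : Matrix (Fin m) (Fin m) (𝕜 → 𝕜)} (hP : ∀ i j, SmoothNear z₀ (P i j))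
    {B : Matrix (Fin m) (Fin m) (𝕜 → 𝕜)} (hB : ∀ i j, SmoothNear z₀ (B i j)) (k : ℕ) :
    iterCoeff (ddz z₀) (mk r hr) (germMatrix P hP) n k =
      (mk r hr ^ n • germMatrix P hP) * germMatrix B hB ↔
    ∀ i j, iterCoeff deriv r P n k i j =ᶠ[𝓝 z₀] ((r ^ n • P) * B) i j := by
  have h1 := map_iterCoeff (δ := deriv) (δ' := germDeriv 𝕜 z₀ 1) (Germ.coeRingHom (𝓝 z₀))
    (fun _ => rfl) r P n k
  have h2 := map_iterCoeff (δ := ddz z₀) (δ' := germDeriv 𝕜 z₀ 1) (SmoothGerm 𝕜 z₀).subtype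
    (fun _ => rfl) (mk r hr) (germMatrix P hP) n k
  have h3 : ((mk r hr ^ n • germMatrix P hP) * germMatrix B hB).map (SmoothGerm 𝕜 z₀).subtype =
      ((r ^ n • P) * B).map (Germ.coeRingHom (𝓝 z₀)) := by
    rw [Matrix.map_mul, Matrix.map_mul, germMatrix_map_subtype]
    congr 1
  have hinj : Function.Injective (fun M : Matrix (Fin m) (Fin m) (SmoothGerm 𝕜 z₀) =>
      M.map (SmoothGerm 𝕜 z₀).subtype) := Matrix.map_injective Subtype.val_injective
  rw [← hinj.eq_iff]
  have h4 : (iterCoeff (ddz z₀) (mk r hr) (germMatrix P hP) n k).map (SmoothGerm 𝕜 z₀).subtype =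
      (iterCoeff deriv r P n k).map (Germ.coeRingHom (𝓝 z₀)) := by
    rw [h1]
    exact h2
  refine (Eq.congr h4 h3).trans ?_
  rw [← Matrix.ext_iff]
  exact forall_congr' fun i => forall_congr' fun j => Germ.coe_eq

theorem derivBy_germ {u y : 𝕜 → 𝕜} (hu : SmoothNear z₀ u) (hy : SmoothNear z₀ y) :
    (derivBy deriv u)^[n] y =ᶠ[𝓝 z₀] 0 ↔ (derivBy (ddz z₀) (mk u hu))^[n] (mk y hy) = 0 := by
  have h1 := map_derivBy_iterate (δ := deriv) (δ' := germDeriv 𝕜 z₀ 1) (Germ.coeRingHom (𝓝 z₀))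
    (fun _ => rfl) u y n
  have h2 := map_derivBy_iterate (δ := ddz z₀) (δ' := germDeriv 𝕜 z₀ 1) (SmoothGerm 𝕜 z₀).subtype
    (fun _ => rfl) (mk u hu) (mk y hy) n
  rw [← Germ.coe_eq, Subtype.ext_iff]
  exact Eq.congr_left (h1.trans h2.symm)

theorem systemOp_germ {B : Fin n → Matrix (Fin m) (Fin m) (𝕜 → 𝕜)} {w : Fin m → 𝕜 → 𝕜}
    (hB : ∀ k i j, SmoothNear z₀ (B k i j)) (hw : ∀ j, SmoothNear z₀ (w j)) :
    (∀ i, systemOp deriv B w i =ᶠ[𝓝 z₀] 0) ↔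
      systemOp (ddz z₀) (fun k => germMatrix (B k) (hB k)) (fun j => mk (w j) (hw j)) = 0 := by
  rw [← mk_systemOp hB hw, funext_iff]
  exact forall_congr' fun i => (mk_zero_iff _).symm

/-- A local diffeomorphism with smooth inverse from the inverse function theorem. -/
theorem exists_openPartialHomeomorph {E : Type*} [NormedAddCommGroup E] [NormedSpace 𝕜 E]
    [FiniteDimensional 𝕜 E] {Ψ : E → E} {p : E} {W : Set E} (hW : IsOpen W) (hp : p ∈ W)
    (hΨ : ∀ q ∈ W, ContDiffAt 𝕜 ∞ Ψ q ∧ Function.Injective (fderiv 𝕜 Ψ q)) :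
    ∃ Φ : OpenPartialHomeomorph E E, p ∈ Φ.source ∧ Φ.source ⊆ W ∧ ⇑Φ = Ψ ∧
      ContDiffOn 𝕜 ∞ Φ Φ.source ∧ ContDiffOn 𝕜 ∞ Φ.symm Φ.target := by
  have : CompleteSpace E := FiniteDimensional.complete 𝕜 E
  have hequiv : ∀ q ∈ W, ∃ L : E ≃L[𝕜] E, HasFDerivAt Ψ (L : E →L[𝕜] E) q := by
    intro q hq
    refine ⟨(LinearEquiv.ofInjectiveEndo (fderiv 𝕜 Ψ q : E →ₗ[𝕜] E)
      (hΨ q hq).2).toContinuousLinearEquiv, ?_⟩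
    convert ((hΨ q hq).1.differentiableAt (by simp)).hasFDerivAt using 1
    ext v; rfl
  obtain ⟨L, hL⟩ := hequiv p hp
  set Φ₀ := (hΨ p hp).1.toOpenPartialHomeomorph Ψ hL (by simp) with hΦ₀
  have hcoe : ⇑(Φ₀.restrOpen W hW) = Ψ := rfl
  have hsrc : (Φ₀.restrOpen W hW).source = Φ₀.source ∩ W := rfl
  refine ⟨Φ₀.restrOpen W hW, ⟨(hΨ p hp).1.mem_toOpenPartialHomeomorph_source hL (by simp), hp⟩,
    fun q hq => hq.2, hcoe, fun q hq => ?_, fun q hq => ?_⟩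
  · rw [hcoe]
    exact (hΨ q hq.2).1.contDiffWithinAt
  · have hq' := (Φ₀.restrOpen W hW).map_target hq
    obtain ⟨L', hL'⟩ := hequiv _ (hsrc ▸ hq').2
    exact ((Φ₀.restrOpen W hW).contDiffAt_symm hq hL' (hΨ _ (hsrc ▸ hq').2).1).contDiffWithinAt

theorem reducible_of_isIsotropicIterative {B N : Fin n → Matrix (Fin m) (Fin m) (𝕜 → 𝕜)}
    (hB : ∀ k i j, SmoothNear z₀ (B k i j)) (hNF : IsNormalForm z₀ B N)
    (hI : IsIsotropicIterative z₀ N) : Reducible z₀ B := by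
  obtain ⟨hN, Q, hQ⟩ := (isNormalForm_iff hB).1 hNF
  obtain ⟨r', P', hr', hP', hrP⟩ := exists_linear_canonical (SmoothGerm.hasFundamentalMatrices z₀)
    hQ ((isIsotropicIterative_iff hN).1 hI)
  have hcoeff := iterCoeff_eq_of_operator_eq ddz_mk_id SmoothGerm.isUnit_natCast hrP
  obtain ⟨r, hr, rfl⟩ := exists_mk r'
  obtain ⟨P, hP, rfl⟩ := exists_germMatrix P'
  have hr0 : r z₀ ≠ 0 := SmoothGerm.isUnit_iff.1 hr'
  have hdet0 : P.det z₀ ≠ 0 := (isUnit_det_germMatrix hP).1 hP'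
  have hrne : ∀ᶠ z in 𝓝 z₀, r z ≠ 0 := hr.self_of_nhds.continuousAt.eventually_ne hr0
  have hdetsm : SmoothNear z₀ P.det := coe_mem_iff.1 (by
    have h1 := RingHom.map_det (Germ.coeRingHom (𝓝 z₀)) P
    have h2 := RingHom.map_det (SmoothGerm 𝕜 z₀).subtype (germMatrix P hP)
    have h3 : (P.det : Germ (𝓝 z₀) 𝕜) = (germMatrix P hP).det := h1.trans h2.symm
    rw [h3]; exact Subtype.property _)
  have hdetne : ∀ᶠ z in 𝓝 z₀, P.det z ≠ 0 := hdetsm.self_of_nhds.continuousAt.eventually_ne hdet0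
  have hrinv : SmoothNear z₀ fun z => (r z)⁻¹ := (hr.and hrne).mono fun z h => h.1.inv h.2
  obtain ⟨X, hX, hX'⟩ := exists_primitive hrinv
  -- Everything known at `z₀` is spread to a neighbourhood `U`, over which the domain of the
  -- transformation will lie.
  have hev : ∀ᶠ z in 𝓝 z₀, SmoothNear z r ∧ SmoothNear z X ∧ (∀ i j, SmoothNear z (P i j)) ∧
      (∀ k i j, SmoothNear z (B k i j)) ∧ deriv X =ᶠ[𝓝 z] (fun z => (r z)⁻¹) ∧ r z ≠ 0 ∧
      P.det z ≠ 0 ∧ ∀ (k : Fin n) i j,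
        iterCoeff deriv r P n k i j =ᶠ[𝓝 z] ((r ^ n • P) * B k) i j := by
    refine (smoothNear_eventually hr).and <| (smoothNear_eventually hX).and <|
      (eventually_all.2 fun i => eventually_all.2 fun j => smoothNear_eventually (hP i j)).and <|
      (eventually_all.2 fun k => eventually_all.2 fun i => eventually_all.2 fun j =>
        smoothNear_eventually (hB k i j)).and <|
      (eventually_eventually_nhds.2 hX').and <| hrne.and <| hdetne.and <|
      eventually_all.2 fun k => eventually_all.2 fun i => eventually_all.2 fun j =>
        eventually_eventually_nhds.2 ?_
    exact (iterCoeff_germ_iff hr hP (hB k) k).1 (hcoeff k) i j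
  obtain ⟨U, hUsub, hUopen, hz₀U⟩ := mem_nhds_iff.1 hev
  let Ψ : 𝕜 × (Fin m → 𝕜) → 𝕜 × (Fin m → 𝕜) := fun q => (X q.1, fun i => ∑ j, P i j q.1 * q.2 j)
  have hPcd : ∀ q : 𝕜 × (Fin m → 𝕜), q.1 ∈ U → ∀ i j,
      ContDiffAt 𝕜 ∞ (fun q : 𝕜 × (Fin m → 𝕜) => P i j q.1) q :=
    fun q hq i j => ((hUsub hq).2.2.1 i j).self_of_nhds.comp q contDiffAt_fst
  -- The derivative is block triangular, with diagonal blocks `X' = 1 / r` and `P`, both invertible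
  -- over `U`.
  have hΨ : ∀ q ∈ Prod.fst ⁻¹' U, ContDiffAt 𝕜 ∞ Ψ q ∧ Function.Injective (fderiv 𝕜 Ψ q) := by
    intro q hq
    have hq' := hUsub hq
    have hsm : ContDiffAt 𝕜 ∞ Ψ q := by
      refine ContDiffAt.prodMk (hq'.2.1.self_of_nhds.comp q contDiffAt_fst) ?_
      refine contDiffAt_pi.2 fun i => ContDiffAt.sum fun j _ => (hPcd q hq i j).mul ?_
      exact contDiffAt_pi.1 contDiffAt_snd j
    refine ⟨hsm, ?_⟩
    have hd := (hsm.differentiableAt (by simp)).hasFDerivAt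
    rw [injective_iff_map_eq_zero]
    rintro ⟨a, b⟩ hab
    have h1 : HasFDerivAt (fun q => (Ψ q).1) _ q := hd.fst
    have h1' : HasFDerivAt (fun q : 𝕜 × (Fin m → 𝕜) => X q.1) _ q :=
      (hq'.2.1.self_of_nhds.differentiableAt (by simp)).hasDerivAt.comp_hasFDerivAt q
        (ContinuousLinearMap.fst 𝕜 𝕜 (Fin m → 𝕜)).hasFDerivAt
    have ha : a = 0 := by
      have h2 := congrArg (fun l : (𝕜 × (Fin m → 𝕜)) →L[𝕜] 𝕜 => l (a, b)) (h1.unique h1')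
      have h3 : deriv X q.1 ≠ 0 := by
        rw [hq'.2.2.2.2.1.self_of_nhds]; exact inv_ne_zero hq'.2.2.2.2.2.1
      simp [hab] at h2
      exact h2.resolve_left h3
    subst ha
    have h4 : (Matrix.of fun i j => P i j q.1) *ᵥ b = 0 := by
      ext i
      have h5 : HasFDerivAt (fun q => (Ψ q).2 i) _ q :=
        (ContinuousLinearMap.proj (R := 𝕜) (φ := fun _ : Fin m => 𝕜) i).hasFDerivAt.comp q hd.snd
      have h6 : HasFDerivAt (fun q : 𝕜 × (Fin m → 𝕜) => ∑ j, P i j q.1 * q.2 j) _ q :=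
        HasFDerivAt.fun_sum fun j _ =>
          ((hPcd q hq i j).differentiableAt (by simp)).hasFDerivAt.mul
            ((ContinuousLinearMap.proj (R := 𝕜) (φ := fun _ : Fin m => 𝕜) j).comp
              (ContinuousLinearMap.snd 𝕜 𝕜 (Fin m → 𝕜))).hasFDerivAt
      have h7 := congrArg (fun l : (𝕜 × (Fin m → 𝕜)) →L[𝕜] 𝕜 => l (0, b)) (h5.unique h6)
      have h8 : ∀ j, fderiv 𝕜 (fun q : 𝕜 × (Fin m → 𝕜) => P i j q.1) q (0, b) = 0 := by
        intro j
        have h9 : HasFDerivAt (fun q : 𝕜 × (Fin m → 𝕜) => P i j q.1) _ q :=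
          ((hq'.2.2.1 i j).self_of_nhds.differentiableAt (by simp)).hasDerivAt.comp_hasFDerivAt q
            (ContinuousLinearMap.fst 𝕜 𝕜 (Fin m → 𝕜)).hasFDerivAt
        rw [h9.fderiv]; simp
      simp [hab, h8] at h7
      simpa [Matrix.mulVec, dotProduct] using h7.symm
    have h9 : (Matrix.of fun i j => P i j q.1).det ≠ 0 := by
      have := RingHom.map_det (Pi.evalRingHom (fun _ : 𝕜 => 𝕜) q.1) P
      intro h
      exact hq'.2.2.2.2.2.2.1 (this.trans h)
    rw [Matrix.eq_zero_of_mulVec_eq_zero h9 h4]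
    rfl
  obtain ⟨Φ, hpΦ, hΦU, hΦ, hΦ1, hΦ2⟩ := exists_openPartialHomeomorph
    (p := ((z₀, 0) : 𝕜 × (Fin m → 𝕜)))
    (hUopen.preimage continuous_fst) hz₀U hΨ
  refine ⟨Φ, ⟨0, hpΦ⟩, hΦ1, hΦ2, ?_⟩
  rintro z₁ w hw hsrc x y rfl rfl -
  obtain ⟨hr1, hX1, hP1, hB1, hX1', hr10, hdet1, hcoeff1⟩ := hUsub (hΦU hsrc)
  have hx : (fun z => (Φ (z, fun j => w j z)).1) = X := by rw [hΦ]
  have hy : (fun i z => (Φ (z, fun j => w j z)).2 i) = P *ᵥ w := by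
    rw [hΦ]
    ext i z
    simp [Ψ, Matrix.mulVec, dotProduct]
  rw [hx, hy]
  have hu : (deriv X)⁻¹ =ᶠ[𝓝 z₁] r := hX1'.mono fun z hz => by simp [hz]
  have husm : SmoothNear z₁ (deriv X)⁻¹ := coe_mem_iff.1 (by
    rw [Germ.coe_eq.2 hu]; exact coe_mem_iff.2 hr1)
  have hmku : mk (deriv X)⁻¹ husm = mk r hr1 := mk_eq_mk.2 hu
  have hid := operator_eq_of_iterCoeff_eq (fun k => (iterCoeff_germ_iff hr1 hP1 (hB1 k) k).2
    (hcoeff1 k)) fun j => mk (w j) (hw j)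
  have hunit : IsUnit (mk r hr1 ^ n • germMatrix P hP1).det := by
    rw [Matrix.det_smul]
    exact (((SmoothGerm.isUnit_iff.2 hr10).pow n).pow _).mul ((isUnit_det_germMatrix hP1).2 hdet1)
  rw [systemOp_germ hB1 hw]
  simp only [derivBy_germ husm (smoothNear_mulVec hP1 hw _), hmku]
  have hmk : ∀ i, mk ((P *ᵥ w) i) (smoothNear_mulVec hP1 hw i) =
      (germMatrix P hP1 *ᵥ fun j => mk (w j) (hw j)) i := congrFun (mk_mulVec hP1 hw)
  simp only [hmk, hid]
  constructor
  · intro h i; rw [h]; simp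
  · intro h
    have := congrArg ((mk r hr1 ^ n • germMatrix P hP1)⁻¹ *ᵥ ·) (funext h)
    simpa only [Matrix.mulVec_mulVec, Matrix.nonsing_inv_mul _ hunit, Matrix.one_mulVec,
      Pi.zero_def, ← Pi.zero_def, Matrix.mulVec_zero] using this

end Smooth

theorem systemOp_add_mul {A : Type*} [CommRing A] (δ : Derivation ℤ A A) {n m : ℕ}
    (B : Fin n → Matrix (Fin m) (Fin m) A) (w φ : Fin m → A) {κ : A} (hκ : δ κ = 0) :
    systemOp δ B (fun j => w j + κ * φ j) = systemOp δ B w + κ • systemOp δ B φ := by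
  have hit : ∀ (k : ℕ) (a b : A), δ^[k] (a + κ * b) = δ^[k] a + κ * δ^[k] b := by
    intro k a b
    induction k with
    | zero => rfl
    | succ k ih =>
      rw [Function.iterate_succ_apply', Function.iterate_succ_apply',
        Function.iterate_succ_apply', ih]
      simp [hκ]
  ext i
  simp only [systemOp, hit, Matrix.mulVec, dotProduct, mul_add, sum_add_distrib, Pi.add_apply,
    Pi.smul_apply, smul_eq_mul, mul_sum]
  simp only [mul_left_comm κ]
  ring

/-! ### Necessity in the smooth setting: one-parameter families of solutions. -/

section Smooth

variable {𝕜 : Type*} [RCLike 𝕜]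

open SmoothGerm

namespace SmoothGerm

variable {E F : Type*} [NormedAddCommGroup E] [NormedSpace 𝕜 E] [NormedAddCommGroup F]
  [NormedSpace 𝕜 F]

/-- The pull-back of germs of smooth functions by a smooth map. -/
def pullback (g : F → E) (hg : ContDiff 𝕜 ∞ g) (p : F) :
    SmoothGerm 𝕜 (g p) →+* SmoothGerm 𝕜 p where
  toFun a := ⟨(a : Germ (𝓝 (g p)) 𝕜).compTendsto g hg.continuous.continuousAt, by
    obtain ⟨_, f, hf, rfl⟩ := a
    exact ⟨_, hf.comp (Eventually.of_forall fun q => hg.contDiffAt), rfl⟩⟩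
  map_zero' := rfl
  map_one' := rfl
  map_add' := by
    rintro ⟨_, f, hf, rfl⟩ ⟨_, g, hg, rfl⟩
    rfl
  map_mul' := by
    rintro ⟨_, f, hf, rfl⟩ ⟨_, g, hg, rfl⟩
    rfl

end SmoothGerm

theorem hasDerivAt_slice {f : 𝕜 × 𝕜 → 𝕜} {z ε : 𝕜} (hf : DifferentiableAt 𝕜 f (z, ε)) :
    HasDerivAt (fun t => f (t, ε)) (fderiv 𝕜 f (z, ε) (1, 0)) z :=
  hf.hasFDerivAt.comp_hasDerivAt (f := fun t => (t, ε)) z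
    ((hasDerivAt_id z).prodMk (hasDerivAt_const z ε))

theorem hasDerivAt_slice_right {f : 𝕜 × 𝕜 → 𝕜} {z ε : 𝕜} (hf : DifferentiableAt 𝕜 f (z, ε)) :
    HasDerivAt (fun t => f (z, t)) (fderiv 𝕜 f (z, ε) (0, 1)) ε :=
  hf.hasFDerivAt.comp_hasDerivAt (f := fun t => (z, t)) ε
    ((hasDerivAt_const ε z).prodMk (hasDerivAt_id ε))

/-- At fixed `ε` the partial derivative in `z` is the ordinary derivative of the slice. The
multiplier `u₁` need only agree with the slice of `u` locally. -/
theorem derivBy_iterate_slice {u y : 𝕜 × 𝕜 → 𝕜} {z ε : 𝕜} {u₁ : 𝕜 → 𝕜}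
    (hu : SmoothAround 𝕜 (z, ε) u) (hy : SmoothAround 𝕜 (z, ε) y)
    (hu₁ : u₁ =ᶠ[𝓝 z] fun t => u (t, ε)) (n : ℕ) :
    SmoothAround 𝕜 (z, ε) ((derivBy (fun f q => fderiv 𝕜 f q (1, 0)) u)^[n] y) ∧
      (derivBy deriv u₁)^[n] (fun t => y (t, ε)) =ᶠ[𝓝 z]
        fun t => (derivBy (fun f q => fderiv 𝕜 f q (1, 0)) u)^[n] y (t, ε) := by
  induction n with
  | zero => exact ⟨hy, EventuallyEq.rfl⟩
  | succ n ih =>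
    obtain ⟨h1, h2⟩ := ih
    simp only [Function.iterate_succ_apply']
    refine ⟨(hu.and (h1.fderiv_apply (1, 0))).mono fun q h => h.1.mul h.2, ?_⟩
    have hcont : ContinuousAt (fun t : 𝕜 => (t, ε)) z := by fun_prop
    filter_upwards [hu₁, h2.deriv, hcont.eventually h1] with t ht1 ht2 ht3
    change u₁ t * deriv _ t = _
    rw [ht1, ht2, (hasDerivAt_slice (ht3.differentiableAt (by simp))).deriv]
    rfl

/-- A germ in `(z, ε)` vanishes if its values at all nearby points do, and each value can be
computed on the slice through that point. -/
theorem derivBy_iterate_eq_zero_of_slices {u y : 𝕜 × 𝕜 → 𝕜} {p : 𝕜 × 𝕜}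
    (hu : SmoothAround 𝕜 p u) (hy : SmoothAround 𝕜 p y) (n : ℕ)
    (h : ∀ᶠ q in 𝓝 p, ∃ u₁ : 𝕜 → 𝕜, u₁ =ᶠ[𝓝 q.1] (fun t => u (t, q.2)) ∧
      (derivBy deriv u₁)^[n] (fun t => y (t, q.2)) q.1 = 0) :
    (derivBy (dirDeriv p (1, 0)) (mk u hu))^[n] (mk y hy) = 0 := by
  have h1 := map_derivBy_iterate (δ := fun f q => fderiv 𝕜 f q (1, 0))
    (δ' := germDeriv 𝕜 p (1, 0)) (Germ.coeRingHom (𝓝 p)) (fun _ => rfl) u y n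
  have h2 := map_derivBy_iterate (δ := dirDeriv p (1, 0)) (δ' := germDeriv 𝕜 p (1, 0))
    (SmoothGerm 𝕜 p).subtype (fun _ => rfl) (mk u hu) (mk y hy) n
  refine Subtype.ext ((h2.trans h1.symm).trans (Germ.coe_eq.2 ?_))
  filter_upwards [h, eventually_eventually_nhds.2 hu, eventually_eventually_nhds.2 hy]
    with q ⟨u₁, hu₁, h0⟩ hu hy
  exact ((derivBy_iterate_slice (z := q.1) (ε := q.2) hu hy hu₁ n).2.self_of_nhds).symm.trans h0

section Coordinates

variable {m : ℕ}

/-- The coordinates of the space of the independent and the dependent variables. -/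
def coordinate (𝕜 : Type*) [RCLike 𝕜] {m : ℕ} (a : Option (Fin m)) :
    (𝕜 × (Fin m → 𝕜)) →L[𝕜] 𝕜 :=
  a.elim (ContinuousLinearMap.fst 𝕜 𝕜 (Fin m → 𝕜)) fun i =>
    (ContinuousLinearMap.proj i).comp (ContinuousLinearMap.snd 𝕜 𝕜 (Fin m → 𝕜))

theorem continuousLinearMap_apply_eq_sum (l : (𝕜 × (Fin m → 𝕜)) →L[𝕜] 𝕜) (c : 𝕜)
    (b : Fin m → 𝕜) :
    l (c, b) = c * l (1, 0) + ∑ j, b j * l (0, Pi.single j 1) := by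
  have h : ((c, b) : 𝕜 × (Fin m → 𝕜)) =
      c • ((1, 0) : 𝕜 × (Fin m → 𝕜)) + ∑ j, b j • (0, (Pi.single j 1 : Fin m → 𝕜)) := by
    ext
    · simp [Prod.fst_sum]
    · simp [Prod.snd_sum, Finset.sum_apply, Pi.single_apply]
  rw [h, map_add, map_smul, map_sum]
  simp only [map_smul, smul_eq_mul]

/-- The Jacobian matrix of a map of the space of the independent and the dependent variables. -/
noncomputable def jacobianMatrix (Φ : 𝕜 × (Fin m → 𝕜) → 𝕜 × (Fin m → 𝕜))
    (q : 𝕜 × (Fin m → 𝕜)) : Matrix (Option (Fin m)) (Option (Fin m)) 𝕜 :=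
  Matrix.of fun a b => fderiv 𝕜 (fun q => coordinate 𝕜 a (Φ q)) q
    (b.elim (1, 0) fun j => (0, Pi.single j 1))

theorem det_jacobianMatrix_ne_zero {Φ Φ' : 𝕜 × (Fin m → 𝕜) → 𝕜 × (Fin m → 𝕜)}
    {q : 𝕜 × (Fin m → 𝕜)} (hΦ : DifferentiableAt 𝕜 Φ q) (hΦ' : DifferentiableAt 𝕜 Φ' (Φ q))
    (h : ∀ᶠ q' in 𝓝 q, Φ' (Φ q') = q') : (jacobianMatrix Φ q).det ≠ 0 := by
  intro hdet
  obtain ⟨b, hb, hb0⟩ := Matrix.exists_mulVec_eq_zero_iff.2 hdet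
  set b' : 𝕜 × (Fin m → 𝕜) := (b none, fun j => b (some j)) with hb'
  have h1 : ∀ a, coordinate 𝕜 a (fderiv 𝕜 Φ q b') = 0 := by
    intro a
    have h2 := congrFun hb0 a
    have h3 : fderiv 𝕜 (fun q => coordinate 𝕜 a (Φ q)) q = (coordinate 𝕜 a).comp (fderiv 𝕜 Φ q) :=
      ((coordinate 𝕜 a).hasFDerivAt.comp q hΦ.hasFDerivAt).fderiv
    simp only [Matrix.mulVec, dotProduct, Fintype.sum_option, jacobianMatrix, Matrix.of_apply,
      Option.elim, Pi.zero_apply] at h2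
    rw [← ContinuousLinearMap.comp_apply, ← h3, hb', continuousLinearMap_apply_eq_sum]
    simpa only [mul_comm] using h2
  have h4 : fderiv 𝕜 Φ q b' = 0 := Prod.ext (h1 none) (funext fun i => h1 (some i))
  have h5 : HasFDerivAt (fun q' => Φ' (Φ q')) ((fderiv 𝕜 Φ' (Φ q)).comp (fderiv 𝕜 Φ q)) q :=
    hΦ'.hasFDerivAt.comp q hΦ.hasFDerivAt
  have h6 := (h5.congr_of_eventuallyEq (EventuallyEq.symm h)).unique (hasFDerivAt_id q)
  have h7 : b' = 0 := by
    have := congrArg (fun l : (𝕜 × (Fin m → 𝕜)) →L[𝕜] 𝕜 × (Fin m → 𝕜) => l b') h6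
    simpa [h4] using this.symm
  refine hb (funext fun o => ?_)
  cases o with
  | none => exact congrArg Prod.fst h7
  | some j => exact congrFun (congrArg Prod.snd h7) j

end Coordinates

section Variation

variable (z₀ : 𝕜)

/-- The restriction of a germ of a function of `(z, ε)` to `ε = 0`. -/
def restriction : SmoothGerm 𝕜 ((z₀, 0) : 𝕜 × 𝕜) →+* SmoothGerm 𝕜 z₀ :=
  pullback (fun z => (z, 0)) (contDiff_id.prodMk contDiff_const) z₀

theorem restriction_mk {f : 𝕜 × 𝕜 → 𝕜} (hf : SmoothAround 𝕜 (z₀, 0) f)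
    {g : 𝕜 → 𝕜} (hg : SmoothAround 𝕜 z₀ g) (h : ∀ᶠ z in 𝓝 z₀, f (z, 0) = g z) :
    restriction z₀ (mk f hf) = mk g hg :=
  Subtype.ext (Germ.coe_eq.2 h)

/-- The derivative with respect to `ε` at `ε = 0` of a germ of a function of `(z, ε)`. -/
noncomputable def firstVariation : SmoothGerm 𝕜 ((z₀, 0) : 𝕜 × 𝕜) →+ SmoothGerm 𝕜 z₀ :=
  (restriction z₀).toAddMonoidHom.comp (dirDeriv (z₀, 0) (0, 1)).toLinearMap.toAddMonoidHom

theorem firstVariation_apply (f : SmoothGerm 𝕜 ((z₀, 0) : 𝕜 × 𝕜)) :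
    firstVariation z₀ f = restriction z₀ (dirDeriv (z₀, 0) (0, 1) f) := rfl

theorem firstVariation_mul (f g : SmoothGerm 𝕜 ((z₀, 0) : 𝕜 × 𝕜)) :
    firstVariation z₀ (f * g) =
      restriction z₀ f * firstVariation z₀ g + firstVariation z₀ f * restriction z₀ g := by
  simp only [firstVariation_apply, Derivation.leibniz, smul_eq_mul, map_add, map_mul]
  ring

theorem restriction_dirDeriv (f : SmoothGerm 𝕜 ((z₀, 0) : 𝕜 × 𝕜)) :
    restriction z₀ (dirDeriv (z₀, 0) (1, 0) f) = ddz z₀ (restriction z₀ f) := by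
  obtain ⟨f, hf, rfl⟩ := exists_mk f
  have hcont : ContinuousAt (fun t : 𝕜 => (t, (0 : 𝕜))) z₀ := by fun_prop
  refine Subtype.ext (Germ.coe_eq.2 ?_)
  filter_upwards [hcont.eventually hf] with z hz
  exact (hasDerivAt_slice (hz.differentiableAt (by simp))).deriv.symm

/-- The variation commutes with `d/dz` because mixed second derivatives agree. -/
theorem firstVariation_dirDeriv (f : SmoothGerm 𝕜 ((z₀, 0) : 𝕜 × 𝕜)) :
    firstVariation z₀ (dirDeriv (z₀, 0) (1, 0) f) = ddz z₀ (firstVariation z₀ f) := by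
  rw [firstVariation_apply, dirDeriv_comm, restriction_dirDeriv]
  rfl

end Variation

variable {z₀ : 𝕜} {n m : ℕ}

theorem systemOp_add_const_mul {B : Fin n → Matrix (Fin m) (Fin m) (𝕜 → 𝕜)}
    {w φ : Fin m → 𝕜 → 𝕜} (hB : ∀ k i j, SmoothNear z₀ (B k i j))
    (hw : ∀ j, SmoothNear z₀ (w j)) (hφ : ∀ j, SmoothNear z₀ (φ j))
    (h : ∀ i, systemOp deriv B w i =ᶠ[𝓝 z₀] 0) (h' : ∀ i, systemOp deriv B φ i =ᶠ[𝓝 z₀] 0)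
    (ε : 𝕜) : (∀ j, SmoothNear z₀ fun z => w j z + ε * φ j z) ∧
      ∀ i, systemOp deriv B (fun j z => w j z + ε * φ j z) i =ᶠ[𝓝 z₀] 0 := by
  have hs : ∀ j, SmoothNear z₀ fun z => w j z + ε * φ j z := fun j =>
    ((hw j).and (hφ j)).mono fun z hz => hz.1.add (contDiffAt_const.mul hz.2)
  refine ⟨hs, (systemOp_germ hB hs).2 ?_⟩
  have h1 := systemOp_add_mul (ddz z₀) (fun k => germMatrix (B k) (hB k))
    (fun j => mk (w j) (hw j)) (fun j => mk (φ j) (hφ j)) (ddz_const ε)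
  rw [(systemOp_germ hB hw).1 h, (systemOp_germ hB hφ).1 h', smul_zero, add_zero] at h1
  exact h1

/-- The formal argument with `ε` as a real or complex variable: restriction to `ε = 0` and `∂/∂ε`
there replace the two parts of a dual number. -/
theorem isIsotropicIterative_of_reducible (hn : 1 ≤ n)
    {B N : Fin n → Matrix (Fin m) (Fin m) (𝕜 → 𝕜)} (hB : ∀ k i j, SmoothNear z₀ (B k i j))
    (hNF : IsNormalForm z₀ B N) (hR : Reducible z₀ B) : IsIsotropicIterative z₀ N := by
  obtain ⟨hN, Q, hQ⟩ := (isNormalForm_iff hB).1 hNF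
  rw [isIsotropicIterative_iff hN]
  obtain rfl | hn2 := hn.eq_or_lt
  · exact isIsotropicIterativeOver_of_order_one hQ.1
  obtain ⟨Φ, ⟨w₀, hw₀⟩, hΦ1, hΦ2, hΦ⟩ := hR
  have hsm : ∀ q ∈ Φ.source, ContDiffAt 𝕜 ∞ Φ q := fun q hq =>
    hΦ1.contDiffAt (Φ.open_source.mem_nhds hq)
  have hJ : (jacobianMatrix Φ (z₀, w₀)).det ≠ 0 :=
    det_jacobianMatrix_ne_zero (Φ' := Φ.symm) ((hsm _ hw₀).differentiableAt (by simp))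
      ((hΦ2.contDiffAt (Φ.open_target.mem_nhds (Φ.map_source hw₀))).differentiableAt (by simp))
      (Φ.eventually_left_inverse hw₀)
  obtain ⟨v, hv⟩ := exists_transversal hJ
  obtain ⟨w', hw', hjet⟩ := exists_solution (SmoothGerm.hasFundamentalMatrices z₀) (const z₀)
    ddz_const (eval z₀) (eval_const z₀) hn (fun k => germMatrix (B k) (hB k))
    (fun q => if (q.1 : ℕ) = 0 then w₀ q.2 else v q.2)
  obtain ⟨w, hw, rfl⟩ := exists_germ_vector w'
  have hwsol := (systemOp_germ hB hw).2 hw'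
  have hw0 : (fun j => w j z₀) = w₀ := funext fun j =>
    (hjet ⟨0, hn⟩ j).trans (if_pos rfl)
  have hw1 : ∀ j, deriv (w j) z₀ = v j := fun j =>
    (hjet ⟨1, hn2⟩ j).trans (if_neg one_ne_zero)
  -- the coordinates of the point transformation and their values along the base solution
  set c : Option (Fin m) → 𝕜 × (Fin m → 𝕜) → 𝕜 := fun a q => coordinate 𝕜 a (Φ q) with hc
  have hcsm : ∀ a, ∀ q ∈ Φ.source, SmoothAround 𝕜 q (c a) := fun a q hq =>
    (eventually_of_mem (Φ.open_source.mem_nhds hq) fun q hq =>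
      (coordinate 𝕜 a).contDiff.contDiffAt.comp q (hsm q hq))
  have hbase : (z₀, fun j => w j z₀) = (z₀, w₀) := by rw [hw0]
  have hγ : ∀ᶠ z in 𝓝 z₀, ContDiffAt 𝕜 ∞ (fun z => (z, fun j => w j z)) z :=
    (eventually_all.2 hw).mono fun z hz => contDiffAt_id.prodMk (contDiffAt_pi.2 hz)
  have hγs : ∀ᶠ z in 𝓝 z₀, (z, fun j => w j z) ∈ Φ.source :=
    hγ.self_of_nhds.continuousAt.eventually_mem (Φ.open_source.mem_nhds (by rwa [hbase]))
  let C : Option (Fin m) → 𝕜 → 𝕜 := fun a z => c a (z, fun j => w j z)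
  have hC : ∀ a, SmoothAround 𝕜 z₀ (C a) := fun a =>
    SmoothAround.comp (f := c a) (by rw [hbase]; exact hcsm a _ hw₀) hγ
  let G : Option (Fin m) → Fin m → 𝕜 → 𝕜 := fun a j z =>
    fderiv 𝕜 (c a) (z, fun j => w j z) (0, Pi.single j 1)
  have hG : ∀ a j, SmoothAround 𝕜 z₀ (G a j) := fun a j =>
    SmoothAround.comp (f := fun q => fderiv 𝕜 (c a) q (0, Pi.single j 1))
      (by rw [hbase]; exact (hcsm a _ hw₀).fderiv_apply _) hγ
  have hslope : ∀ a, eval z₀ (ddz z₀ (mk (C a) (hC a))) = jacobianMatrix Φ (z₀, w₀) a none +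
      ∑ j, jacobianMatrix Φ (z₀, w₀) a (some j) * v j := by
    intro a
    have h1 : HasDerivAt (C a)
        (fderiv 𝕜 (c a) (z₀, fun j => w j z₀) (1, fun j => deriv (w j) z₀)) z₀ := by
      have hd : DifferentiableAt 𝕜 (c a) (z₀, fun j => w j z₀) := by
        rw [hw0]; exact (hcsm a _ hw₀).self_of_nhds.differentiableAt (by simp)
      exact hd.hasFDerivAt.comp_hasDerivAt (f := fun z => (z, fun j => w j z)) z₀
        ((hasDerivAt_id z₀).prodMk (hasDerivAt_pi.2 fun j =>
          ((hw j).self_of_nhds.differentiableAt (by simp)).hasDerivAt))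
    rw [ddz_mk, eval_mk, h1.deriv, hw0, continuousLinearMap_apply_eq_sum]
    simp only [one_mul, hw1, mul_comm (v _)]
    rfl
  have hunit : IsUnit (ddz z₀ (mk (C none) (hC none))) :=
    SmoothGerm.isUnit_iff.2 (by rw [hslope]; exact hv)
  obtain ⟨u, hu⟩ := hunit.exists_left_inv
  -- As in the formal case, `P φ` is the characteristic of the variation in direction `φ`.
  let P : Matrix (Fin m) (Fin m) (SmoothGerm 𝕜 z₀) := Matrix.of fun i j =>
    mk (G (some i) j) (hG _ j) -
      u * ddz z₀ (mk (C (some i)) (hC _)) * mk (G none j) (hG none j)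
  have huu : IsUnit u := IsUnit.of_mul_eq_one _ hu
  have hGJ : ∀ a j, eval z₀ (mk (G a j) (hG a j)) = jacobianMatrix Φ (z₀, w₀) a (some j) := by
    intro a j
    change fderiv 𝕜 (c a) (z₀, fun j => w j z₀) _ = _
    rw [hw0]
    rfl
  have hP : IsUnit P.det := by
    rw [SmoothGerm.isUnit_iff, RingHom.map_det]
    convert det_transversal_ne_zero hJ v
      (fun i => eval z₀ (ddz z₀ (mk (C (some i)) (hC _)))) (eval z₀ u) ?_ ?_ using 2
    · ext i j
      simp only [RingHom.mapMatrix_apply, Matrix.map_apply, P, Matrix.of_apply, map_sub, map_mul,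
        hGJ]
    · rw [← hslope, ← map_mul, hu, map_one]
    · exact fun i => hslope _
  refine isIsotropicIterativeOver_of_solutions ddz_mk_id SmoothGerm.isUnit_natCast
    (SmoothGerm.hasFundamentalMatrices z₀) hn hQ huu hP fun φ' hφ' i => ?_
  obtain ⟨φ, hφ, rfl⟩ := exists_germ_vector φ'
  have hφsol := (systemOp_germ hB hφ).2 hφ'
  -- The family of solution curves `w + ε φ`, which starts at the base solution for `ε = 0`.
  let Γ : 𝕜 × 𝕜 → 𝕜 × (Fin m → 𝕜) := fun q => (q.1, fun j => w j q.1 + q.2 * φ j q.1)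
  have hfst : ∀ {s : 𝕜 → Prop}, (∀ᶠ z in 𝓝 z₀, s z) →
      ∀ᶠ q : 𝕜 × 𝕜 in 𝓝 (z₀, 0), s q.1 := fun h =>
    (continuous_fst.tendsto ((z₀, 0) : 𝕜 × 𝕜)).eventually h
  have hΓ : ∀ᶠ q in 𝓝 (z₀, 0), ContDiffAt 𝕜 ∞ Γ q := by
    filter_upwards [hfst (eventually_all.2 hw), hfst (eventually_all.2 hφ)] with q h1 h2
    exact contDiffAt_fst.prodMk (contDiffAt_pi.2 fun j =>
      ((h1 j).comp q contDiffAt_fst).add (contDiffAt_snd.mul ((h2 j).comp q contDiffAt_fst)))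
  have hΓ0 : ∀ z, Γ (z, 0) = (z, fun j => w j z) := fun z => by simp [Γ]
  have hΓbase : Γ (z₀, 0) = (z₀, w₀) := by rw [hΓ0, hw0]
  have hΓs : ∀ᶠ q in 𝓝 (z₀, 0), Γ q ∈ Φ.source :=
    hΓ.self_of_nhds.continuousAt.eventually_mem (Φ.open_source.mem_nhds (by rwa [hΓbase]))
  let H : Option (Fin m) → 𝕜 × 𝕜 → 𝕜 := fun a q => c a (Γ q)
  have hH : ∀ a, SmoothAround 𝕜 (z₀, 0) (H a) := fun a =>
    SmoothAround.comp (f := c a) (by rw [hΓbase]; exact hcsm a _ hw₀) hΓ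
  have hreH : ∀ a, restriction z₀ (mk (H a) (hH a)) = mk (C a) (hC a) := fun a =>
    restriction_mk z₀ (hH a) (hC a) (Eventually.of_forall fun z => by simp only [H, C, hΓ0])
  have himH : ∀ a, firstVariation z₀ (mk (H a) (hH a)) =
      ∑ j, mk (φ j) (hφ j) * mk (G a j) (hG a j) := by
    intro a
    have hsum : SmoothAround 𝕜 z₀ fun z => ∑ j, φ j z * G a j z := by
      filter_upwards [eventually_all.2 hφ, eventually_all.2 (hG a)] with z h1 h2
      exact ContDiffAt.sum fun j _ => (h1 j).mul (h2 j)
    have h1 : ∑ j, mk (φ j) (hφ j) * mk (G a j) (hG a j) = mk _ hsum := by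
      refine Subtype.ext ?_
      rw [AddSubmonoidClass.coe_finsetSum, coe_mk]
      have : (fun z => ∑ j, φ j z * G a j z) = ∑ j, φ j * G a j := by ext z; simp
      rw [this, ← Germ.coe_coeRingHom, map_sum]
      rfl
    rw [h1, firstVariation_apply, dirDeriv_mk]
    refine restriction_mk z₀ _ _ ?_
    have hcont : ContinuousAt (fun t : 𝕜 => (t, (0 : 𝕜))) z₀ := by fun_prop
    filter_upwards [hcont.eventually (hH a), hγs] with z hz hzs
    have h2 := hasDerivAt_slice_right (hz.differentiableAt (by simp))
    have h3 : HasDerivAt (fun t => H a (z, t))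
        (fderiv 𝕜 (c a) (Γ (z, 0)) (0, fun j => 1 * φ j z)) 0 := by
      have hd : DifferentiableAt 𝕜 (c a) (Γ (z, 0)) := by
        rw [hΓ0]; exact (hcsm a _ hzs).self_of_nhds.differentiableAt (by simp)
      exact hd.hasFDerivAt.comp_hasDerivAt (f := fun t => Γ (z, t)) (0 : 𝕜)
        ((hasDerivAt_const (0 : 𝕜) z).prodMk (hasDerivAt_pi.2 fun j =>
          ((hasDerivAt_id (0 : 𝕜)).mul_const (φ j z)).const_add (w j z)))
    rw [h2.unique h3, hΓ0, continuousLinearMap_apply_eq_sum]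
    simp only [zero_mul, one_mul, zero_add]
    rfl
  have hunit' : fderiv 𝕜 (H none) (z₀, 0) (1, 0) ≠ 0 := by
    have h1 := congrArg (eval z₀) (restriction_dirDeriv z₀ (mk (H none) (hH none)))
    rw [hreH] at h1
    have h2 := SmoothGerm.isUnit_iff.1 hunit
    rw [← h1] at h2
    exact h2
  have hHd := (hH none).fderiv_apply (1, 0)
  have hne : ∀ᶠ q in 𝓝 (z₀, 0), fderiv 𝕜 (H none) q (1, 0) ≠ 0 :=
    hHd.self_of_nhds.continuousAt.eventually_ne hunit'
  have hU : SmoothAround 𝕜 (z₀, 0) fun q => (fderiv 𝕜 (H none) q (1, 0))⁻¹ :=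
    (hHd.and hne).mono fun q h => h.1.inv h.2
  have hu' : mk _ hU * dirDeriv (z₀, 0) (1, 0) (mk (H none) (hH none)) = 1 := by
    refine Subtype.ext (Germ.coe_eq.2 ?_)
    filter_upwards [hne] with q hq
    exact inv_mul_cancel₀ hq
  have hreu : restriction z₀ (mk _ hU) = u := by
    have h1 := congrArg (restriction z₀) hu'
    rw [map_mul, restriction_dirDeriv, hreH, map_one] at h1
    exact hunit.mul_right_cancel (h1.trans hu.symm)
  have hsol : (derivBy (dirDeriv (z₀, 0) (1, 0)) (mk _ hU))^[n]
      (mk (H (some i)) (hH (some i))) = 0 := by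
    -- The canonical equation is needed at every `(z, ε)` near `(z₀, 0)`. It comes from applying the
    -- transformation property at the point `z` to the single curve with this `ε`.
    refine derivBy_iterate_eq_zero_of_slices hU (hH _) n ?_
    have hev : ∀ᶠ z in 𝓝 z₀, (∀ k i j, SmoothNear z (B k i j)) ∧ (∀ j, SmoothNear z (w j)) ∧
        (∀ j, SmoothNear z (φ j)) ∧ (∀ i, systemOp deriv B w i =ᶠ[𝓝 z] 0) ∧
        ∀ i, systemOp deriv B φ i =ᶠ[𝓝 z] 0 :=
      (eventually_all.2 fun k => eventually_all.2 fun i => eventually_all.2 fun j =>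
        smoothNear_eventually (hB k i j)).and <|
      (eventually_all.2 fun j => smoothNear_eventually (hw j)).and <|
      (eventually_all.2 fun j => smoothNear_eventually (hφ j)).and <|
      (eventually_all.2 fun i => eventually_eventually_nhds.2 (hwsol i)).and <|
      eventually_all.2 fun i => eventually_eventually_nhds.2 (hφsol i)
    filter_upwards [hfst hev, hΓs, eventually_eventually_nhds.2 (hH none), hne]
      with ⟨z, ε⟩ ⟨hB1, hw1, hφ1, hws, hφs⟩ hsrc hHq hneq
    obtain ⟨hcs, hcsol⟩ := systemOp_add_const_mul hB1 hw1 hφ1 hws hφs ε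
    have hcont : ContinuousAt (fun t : 𝕜 => (t, ε)) z := by fun_prop
    have hder : ∀ᶠ t in 𝓝 z, deriv (fun t => H none (t, ε)) t =
        fderiv 𝕜 (H none) (t, ε) (1, 0) := by
      filter_upwards [hcont.eventually hHq] with t ht
      exact (hasDerivAt_slice (ht.differentiableAt (by simp))).deriv
    refine ⟨(deriv fun t => H none (t, ε))⁻¹, hder.mono fun t ht => by simp [ht], ?_⟩
    exact ((hΦ z (fun j t => w j t + ε * φ j t) hcs hsrc _ _ rfl rfl (by
      have := hder.self_of_nhds
      change deriv (fun t => H none (t, ε)) z ≠ 0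
      rw [this]; exact hneq)).1 hcsol i).self_of_nhds
  have hvar := variation_derivBy_iterate (δ := ddz z₀) (δ' := dirDeriv (z₀, 0) (1, 0))
    (restriction z₀) (firstVariation z₀) (firstVariation_mul z₀) (restriction_dirDeriv z₀)
    (firstVariation_dirDeriv z₀) hu' (mk (H (some i)) (hH (some i))) n
  have hzero : (derivBy (ddz z₀) u)^[n] (mk (C (some i)) (hC (some i))) = 0 := by
    rw [← hreu, ← hreH, ← map_derivBy_iterate (δ := dirDeriv (z₀, 0) (1, 0)) (δ' := ddz z₀)
      (restriction z₀) (restriction_dirDeriv z₀), hsol, map_zero]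
  rw [hsol, map_zero, hreu, hreH, himH, himH, Function.iterate_succ_apply', hzero] at hvar
  have h0 : derivBy (ddz z₀) u 0 = 0 := by simp [derivBy]
  rw [h0, zero_mul, add_zero] at hvar
  rw [hvar]
  congr 1
  simp only [P, Matrix.mulVec, dotProduct, Matrix.of_apply, derivBy, mul_sum, ← sum_sub_distrib]
  exact sum_congr rfl fun j _ => by ring

end Smooth

end LinearODE

theorem theorem2 (n m : ℕ) (hn : 1 ≤ n) :
    (∀ (𝕜 : Type*) [RCLike 𝕜] (z₀ : 𝕜) (B : Fin n → Matrix (Fin m) (Fin m) (𝕜 → 𝕜)),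
      (∀ k i j, LinearODE.SmoothNear z₀ (B k i j)) →
        (∃ N, LinearODE.IsNormalForm z₀ B N) ∧
        ∀ N, LinearODE.IsNormalForm z₀ B N →
          (LinearODE.Reducible z₀ B ↔ LinearODE.IsIsotropicIterative z₀ N)) ∧
    (∀ (K : Type*) [Field K] [CharZero K]
      (B : Fin n → Matrix (Fin m) (Fin m) (PowerSeries K)),
        (∃ N, LinearODE.Formal.IsNormalForm B N) ∧
        ∀ N, LinearODE.Formal.IsNormalForm B N →
          (LinearODE.Formal.Reducible B ↔ LinearODE.Formal.IsIsotropicIterative N)) := by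
  refine ⟨fun 𝕜 _ z₀ B hB => ⟨LinearODE.exists_isNormalForm hn hB, fun N hN =>
    ⟨LinearODE.isIsotropicIterative_of_reducible hn hB hN,
      LinearODE.reducible_of_isIsotropicIterative hB hN⟩⟩, fun K _ _ B => ⟨?_, fun N hN =>
    ⟨LinearODE.Formal.isIsotropicIterative_of_reducible hn hN,
      LinearODE.Formal.reducible_of_isIsotropicIterative hN⟩⟩⟩
  obtain ⟨N, Q, h⟩ := LinearODE.exists_isNormalFormVia LinearODE.Formal.isUnit_natCast
    LinearODE.Formal.hasFundamentalMatrices hn B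
  exact ⟨N, LinearODE.Formal.isNormalForm_iff.2 ⟨Q, h⟩⟩
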